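/- Let $\mu$ be a continuous probability density on $[0,1]$ with $0<\mu\le M$ on $[0,1]$, let $s:[0,1]\to\mathbb R$ be $C$-Lipschitz, and let $\varepsilon$ be a real random variable with $\mathbb E[\varepsilon]=0$ and $\operatorname{Var}(\varepsilon)=\sigma^2<\infty$. For $n\ge 1$ let $X_1,\dots,X_n$ have density $\mu$, let $\varepsilon_1,\dots,\varepsilon_n$ be distributed as $\varepsilon$, and let $Y_i=s(X_i)+\varepsilon_i$. Let $k=k_n$ and $q=q_n$ be integers, let $U^l_j$ ($1\le l\le q$, $1\le j\le k$) be uniform on $[0,1]$, and let $X$ be a further random variable with density $\mu$; all the variables $X_i$, $\varepsilon_i$, $U^l_j$, $X$ are mutually independent. For $1\le l\le q$ let $U^l_{(1)}\le\dots\le U^l_{(k)}$ be the order statistics of $U^l_1,\dots,U^l_k$, and set $U^l_{(0)}=0$, $U^l_{(k+1)}=1$. The $l$-th purely uniformly random tree is $$\hat s_{l}(x)=\sum_{j=0}^{k}\hat\beta^l_j\,\mathbf 1_{U^l_{(j)}<x\le U^l_{(j+1)}},\qquad x\in[0,1],$$ where $\hat\beta^l_j$ is the average of the $Y_i$ over those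 $i$ with $U^l_{(j)}<X_i\le U^l_{(j+1)}$, and $\hat\beta^l_j=0$ if there is no such $i$. The purely uniformly random forest is $\hat s(x)=\frac1q\sum_{l=1}^q\hat s_l(x)$. **Theorem.** If $k_n\to\infty$, $k_n/n\to0$ and $q_n\to\infty$ as $n\to\infty$, then $(\hat s(X)-s(X))^2$ is integrable and the quadratic risk of the forest satisfies $$\mathbb E\big[(\hat s(X)-s(X))^2\big]\le\frac34\,\frac{\sigma^2(k_n+1)}{n}+\frac{6MC^2}{(k_n+1)^2}+o\!\left(\frac{k_n}{n}\right)\qquad(n\to\infty),$$ where the $o(k_n/n)$ term depends on $n$, $\mu$, $s$, $M$, $C$, the law of $\varepsilon$ and the sequences $(k_n)$, $(q_n)$ only. -/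

import Mathlib

open MeasureTheory ProbabilityTheory Filter Topology Asymptotics Set
open scoped NNReal ENNReal

noncomputable section

namespace PURF

/-- The knots `U_(0) = 0, U_(1) ≤ ⋯ ≤ U_(k), U_(k+1) = 1`: the order statistics of the vector
`u`, completed by the two end points of `[0, 1]`. -/
def knot {k : ℕ} (u : Fin k → ℝ) : Fin (k + 2) → ℝ :=
  Fin.cons 0 (Fin.snoc (u ∘ Tuple.sort u) 1)

/-- The cell `(U_(j), U_(j+1)]`, for `j = 0, …, k`. -/
def cell {k : ℕ} (u : Fin k → ℝ) (j : Fin (k + 1)) : Set ℝ :=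
  Ioc (knot u j.castSucc) (knot u j.succ)

open Classical in
/-- The indices `i` of the observations that fall in the `j`-th cell. -/
def cellIndices {k n : ℕ} (u : Fin k → ℝ) (x : Fin n → ℝ) (j : Fin (k + 1)) : Finset (Fin n) :=
  Finset.univ.filter fun i => x i ∈ cell u j

/-- The average of the responses in the `j`-th cell. It is `0` when the cell contains no
observation, because of the convention `a / 0 = 0`. -/
def cellMean {k n : ℕ} (u : Fin k → ℝ) (x y : Fin n → ℝ) (j : Fin (k + 1)) : ℝ :=
  (∑ i ∈ cellIndices u x j, y i) / ((cellIndices u x j).card : ℝ)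

/-- The tree: the regressogram built on the partition given by `u`, from the learning sample
`(x i, y i)`, evaluated at `t`. -/
def tree {k n : ℕ} (u : Fin k → ℝ) (x y : Fin n → ℝ) (t : ℝ) : ℝ :=
  ∑ j : Fin (k + 1), (cell u j).indicator (fun _ => cellMean u x y j) t

/-- The forest: the average of the `q` trees built on the partitions `v 0, …, v (q - 1)`. -/
def forest {k n q : ℕ} (v : Fin q → Fin k → ℝ) (x y : Fin n → ℝ) (t : ℝ) : ℝ :=
  (1 / (q : ℝ)) * ∑ l : Fin q, tree (v l) x y t

/-- The distribution on `[0, 1]` with Lebesgue density `μ`. -/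
def designLaw (μ : ℝ → ℝ) : Measure ℝ :=
  (volume.restrict (Icc 0 1)).withDensity fun x => ENNReal.ofReal (μ x)

/-- The random variables that enter the estimator with sample size `n`, `q` trees and `k`
splitting points per tree: the design points `X i` and the test point `X₀` have density `μ` on
`[0, 1]`, the noise variables `ε i` have law `ν`, the splitting points `U l j` are uniform on
`[0, 1]`, and all these variables are mutually independent. -/
structure IsModel (μ : ℝ → ℝ) (ν : Measure ℝ) {n k q : ℕ} {Ω : Type*} [MeasurableSpace Ω]
    (P : Measure Ω) (X ε : Fin n → Ω → ℝ) (U : Fin q → Fin k → Ω → ℝ) (X₀ : Ω → ℝ) : Prop where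
  law_design : ∀ i, HasLaw (X i) (designLaw μ) P
  law_noise : ∀ i, HasLaw (ε i) ν P
  law_split : ∀ l j, HasLaw (U l j) (volume.restrict (Icc 0 1)) P
  law_test : HasLaw X₀ (designLaw μ) P
  indep : iIndepFun
    (Sum.elim (Sum.elim X ε) (Sum.elim (fun p : Fin q × Fin k => U p.1 p.2)
      (fun _ : Unit => X₀))) P

/-- The squared error `(ŝ(X₀) - s(X₀))²` of the forest at the test point, where the forest is
built from the learning sample `(X i, s (X i) + ε i)`. -/
def sqError (s : ℝ → ℝ) {n k q : ℕ} {Ω : Type*}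
    (X ε : Fin n → Ω → ℝ) (U : Fin q → Fin k → Ω → ℝ) (X₀ : Ω → ℝ) (ω : Ω) : ℝ :=
  (forest (fun l j => U l j ω) (fun i => X i ω) (fun i => s (X i ω) + ε i ω) (X₀ ω)
    - s (X₀ ω)) ^ 2

end PURF

end

/-! Each tree is a weighted sum of the responses, so the forest is one too, with averaged weights
`forestWeight`. Integrating out the centred noise (`IsModel.lintegral_noise_eq`) leaves `σ ^ 2`
times the mean of the sum of squared weights, plus the mean squared bias.

Variance: the sum of squared forest weights is an average over pairs of trees. The diagonal pairs
contribute O(k/(nq)). For two different trees, let A and B be the cells of the test point; the pair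
contributes |A ∩ B| / (|A| |B|) ≤ 1 / |A ∪ B|, where |·| counts observations
(`sum_weight_mul_weight_le`), and the mean of 1/(|A ∪ B| + 1) is at most 1/(n + 1) over the mass of
A ∪ B (`lintegral_inv_hits_add_one_le`). Pool the 2k splitting points: A ∪ B contains the pooled gap
of the test point and both neighbouring gaps. By exchangeability the middle gap takes on average a
third of the three, so the mean of 1/length(A ∪ B) is at most (2k + 7)/3 (`lintegral_inv_wide_le`),
against k + 1 for a single tree. This is the gain of the forest: the leading constant is 2/3, and
the slack up to 3/4 pays for replacing the density by a locally constant one (factor 10/9) and for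
passing from 1/N to 1/(N + 1) (factor 101/100).

Bias: by convexity a single tree suffices. Its bias is at most C times the cell length, whose second
moment under the uniform law is at most the probability 6/((k + 3)(k + 2)) that three uniform points
share a cell (`measure_three_same_block_le`).

Sparse cells: both estimates fail when the cell holds fewer than 100 observations. A cell shorter
than τ needs splitting points on both sides of the test point, except near the ends of the interval,
so this has probability O((kτ)²). With a suitable τ, sparse cells have probability o(k/n)
(`lintegral_measure_hits_lt_le`). -/

noncomputable section

namespace PURF

/-! ### Cells as level sets of a counting function -/

/-- The number of coordinates of `u` that lie strictly below `x`. -/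
def cnt {ι : Type*} [Fintype ι] (u : ι → ℝ) (x : ℝ) : ℕ :=
  (Finset.univ.filter fun j => u j < x).card

lemma cnt_mono {ι : Type*} [Fintype ι] (u : ι → ℝ) : Monotone (cnt u) := fun x y hxy =>
  Finset.card_le_card fun j => by simpa using fun h => h.trans_le hxy

lemma cnt_le {ι : Type*} [Fintype ι] (u : ι → ℝ) (x : ℝ) : cnt u x ≤ Fintype.card ι :=
  Finset.card_le_univ _

lemma cnt_comp_perm {ι : Type*} [Fintype ι] (u : ι → ℝ) (e : Equiv.Perm ι) (x : ℝ) :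
    cnt (u ∘ e) x = cnt u x :=
  Finset.card_bijective e e.bijective (by simp)

lemma measurable_cnt {ι : Type*} [Fintype ι] :
    Measurable fun p : (ι → ℝ) × ℝ => cnt p.1 p.2 := by
  unfold cnt
  simp only [Finset.card_filter]
  refine Finset.measurable_fun_sum _ fun j _ => Measurable.ite ?_ measurable_const measurable_const
  exact measurableSet_lt (by fun_prop) (by fun_prop)

lemma Measurable.cnt {ι α : Type*} [Fintype ι] [MeasurableSpace α] {f : α → ι → ℝ} {g : α → ℝ}
    (hf : Measurable f) (hg : Measurable g) : Measurable fun a => PURF.cnt (f a) (g a) :=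
  measurable_cnt.comp (hf.prodMk hg)

/-- After sorting, the points below `t` form an initial segment, so the order statistics can be
forgotten in favour of `cnt`. The shift by one from the knot at 0 makes the rank bound non-strict.
-/
lemma knot_lt_iff {k : ℕ} (u : Fin k → ℝ) {t : ℝ} (ht : t ∈ Ioc (0 : ℝ) 1) (j : Fin (k + 2)) :
    knot u j < t ↔ (j : ℕ) ≤ cnt u t := by
  have hmono : Monotone (u ∘ Tuple.sort u) := Tuple.monotone_sort u
  rw [← cnt_comp_perm u (Tuple.sort u)]
  set v := u ∘ Tuple.sort u
  unfold knot
  refine Fin.cases ?_ (fun j => ?_) j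
  · simpa using ht.1
  · rw [Fin.cons_succ]
    refine Fin.lastCases ?_ (fun j => ?_) j
    · have := cnt_le v t
      simp only [Fin.snoc_last, Fin.val_succ, Fin.val_last]
      rw [Fintype.card_fin] at this
      constructor
      · intro h; linarith [ht.2]
      · intro h; omega
    · simp only [Fin.snoc_castSucc, Fin.val_succ, Fin.val_castSucc]
      constructor
      · intro h
        calc (j : ℕ) + 1 = (Finset.Iic j).card := by simp
          _ ≤ _ := Finset.card_le_card fun i hi => by
            simpa using (hmono (Finset.mem_Iic.1 hi)).trans_lt h
      · intro h
        by_contra hj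
        have : cnt v t ≤ (Finset.Iio j).card := Finset.card_le_card fun i hi => by
          simp only [Finset.mem_filter, Finset.mem_univ, true_and] at hi
          rw [Finset.mem_Iio]
          by_contra hij
          exact hj ((hmono (not_lt.1 hij)).trans_lt hi)
        simp at this
        omega

lemma mem_cell_iff {k : ℕ} (u : Fin k → ℝ) {t : ℝ} (ht : t ∈ Ioc (0 : ℝ) 1) (j : Fin (k + 1)) :
    t ∈ cell u j ↔ cnt u t = j := by
  have h1 := knot_lt_iff u ht j.castSucc
  have h2 := knot_lt_iff u ht j.succ
  simp only [Fin.val_castSucc, Fin.val_succ] at h1 h2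
  rw [cell, mem_Ioc, h1, ← not_lt (b := t), h2]
  omega

/-- The number of points of `x` in `A`. -/
def hits {n : ℕ} (A : Set ℝ) (x : Fin n → ℝ) : ℕ :=
  ∑ i, A.indicator (fun _ => 1) (x i)

/-- The set of points with the same number of splitting points below them as `t`. -/
def block {ι : Type*} [Fintype ι] (u : ι → ℝ) (t : ℝ) : Set ℝ := {y | cnt u y = cnt u t}

/-- The weight of the `i`-th response in the tree at `t`. -/
def weight {k n : ℕ} (u : Fin k → ℝ) (x : Fin n → ℝ) (t : ℝ) (i : Fin n) : ℝ :=
  (block u t).indicator (fun _ => ((hits (block u t) x : ℕ) : ℝ)⁻¹) (x i)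

lemma tree_eq_sum_weight {k n : ℕ} (u : Fin k → ℝ) {x : Fin n → ℝ} (y : Fin n → ℝ) {t : ℝ}
    (ht : t ∈ Ioc (0 : ℝ) 1) (hx : ∀ i, x i ∈ Ioc (0 : ℝ) 1) :
    tree u x y t = ∑ i, weight u x t i * y i := by
  classical
  have hlt : cnt u t < k + 1 := by have := cnt_le u t; rw [Fintype.card_fin] at this; omega
  unfold tree
  rw [Finset.sum_eq_single (⟨cnt u t, hlt⟩ : Fin (k + 1))]
  · rw [indicator_of_mem ((mem_cell_iff u ht _).2 rfl)]
    have hc : cellIndices u x ⟨cnt u t, hlt⟩ = Finset.univ.filter fun i => x i ∈ block u t := by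
      unfold cellIndices
      ext i
      rw [Finset.mem_filter, Finset.mem_filter, mem_cell_iff u (hx i)]
      rfl
    rw [cellMean, hc]
    have : (Finset.univ.filter fun i => x i ∈ block u t).card = hits (block u t) x := by
      rw [Finset.card_filter]; rfl
    rw [this, Finset.sum_filter, Finset.sum_div]
    refine Finset.sum_congr rfl fun i _ => ?_
    by_cases h : x i ∈ block u t
    · simp [weight, h, div_eq_inv_mul]
    · simp [weight, h]
  · intro j _ hj
    refine indicator_of_notMem ?_ _
    rw [mem_cell_iff u ht]
    intro h
    exact hj (Fin.ext h.symm)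
  · simp

/-! ### From independent variables to product integrals -/

section Transfer

/-- The injection `g` selects the variables that the integrand sees; all others are integrated away
by independence. -/
lemma lintegral_comp_eq_lintegral_pi {Ω I J : Type*} [MeasurableSpace Ω] {P : Measure Ω}
    [IsProbabilityMeasure P] [Fintype J] {f : I → Ω → ℝ} {m : I → Measure ℝ}
    (hind : iIndepFun f P) (hlaw : ∀ i, HasLaw (f i) (m i) P) {g : J → I}
    (hg : Function.Injective g) {F : (J → ℝ) → ℝ≥0∞} (hF : Measurable F) :
    ∫⁻ ω, F (fun j => f (g j) ω) ∂P = ∫⁻ z, F z ∂Measure.pi fun j => m (g j) := by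
  have hae : ∀ j, AEMeasurable (f (g j)) P := fun j => (hlaw (g j)).aemeasurable
  have h := (iIndepFun_iff_map_fun_eq_pi_map hae).1 (hind.precomp hg)
  simp only [(hlaw _).map_eq] at h
  rw [← h, lintegral_map' hF.aemeasurable (aemeasurable_pi_lambda _ hae)]

lemma lintegral_pi_sum {I J : Type*} [Fintype I] [Fintype J] (m : I ⊕ J → Measure ℝ)
    [∀ i, IsProbabilityMeasure (m i)] {F : (I ⊕ J → ℝ) → ℝ≥0∞} (hF : Measurable F) :
    ∫⁻ z, F z ∂Measure.pi m = ∫⁻ a, ∫⁻ b, F (Sum.elim a b) ∂Measure.pi (fun j => m (.inr j))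
      ∂Measure.pi (fun i => m (.inl i)) := by
  have h := measurePreserving_sumPiEquivProdPi_symm (X := fun _ : I ⊕ J => ℝ) m
  rw [← h.lintegral_comp hF, lintegral_prod]
  · rfl
  · exact (hF.comp h.measurable).aemeasurable

lemma measurable_sumElim {I J : Type*} :
    Measurable fun p : (I → ℝ) × (J → ℝ) => (Sum.elim p.1 p.2 : I ⊕ J → ℝ) := by
  rw [measurable_pi_iff]
  rintro (i | j)
  · exact (measurable_pi_apply i).comp measurable_fst
  · exact (measurable_pi_apply j).comp measurable_snd

lemma lintegral_pi_unit (m : Unit → Measure ℝ) [∀ i, IsProbabilityMeasure (m i)]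
    {F : (Unit → ℝ) → ℝ≥0∞} (hF : Measurable F) :
    ∫⁻ z, F z ∂Measure.pi m = ∫⁻ t, F (fun _ => t) ∂m () := by
  have h := (measurePreserving_eval m ()).lintegral_comp (f := fun t => F fun _ => t)
    (hF.comp (by fun_prop))
  rw [← h]


lemma lintegral_pi_fin_succ {d : ℕ} (m : Measure ℝ) [IsProbabilityMeasure m]
    {F : (Fin (d + 1) → ℝ) → ℝ≥0∞} (hF : Measurable F) :
    ∫⁻ w, F w ∂Measure.pi (fun _ => m) =
      ∫⁻ x, ∫⁻ u, F (Fin.cons x u) ∂Measure.pi (fun _ => m) ∂m := by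
  have h := (measurePreserving_piFinSuccAbove (fun _ : Fin (d + 1) => m) 0).symm
  rw [← h.lintegral_comp hF, lintegral_prod]
  · simp [MeasurableEquiv.piFinSuccAbove, Fin.consEquiv]
  · exact (hF.comp h.measurable).aemeasurable

lemma lintegral_pi_comp_perm {ι : Type*} [Fintype ι] (m : Measure ℝ) [IsProbabilityMeasure m]
    (e : Equiv.Perm ι) {F : (ι → ℝ) → ℝ≥0∞} (hF : Measurable F) :
    ∫⁻ w, F (w ∘ e) ∂Measure.pi (fun _ => m) = ∫⁻ w, F w ∂Measure.pi (fun _ => m) := by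
  have h := measurePreserving_piCongrLeft (fun _ : ι => m) e.symm
  rw [← h.lintegral_comp hF]
  refine lintegral_congr fun w => congrArg F (funext fun i => ?_)
  have := MeasurableEquiv.piCongrLeft_apply_apply (β := fun _ : ι => ℝ) e.symm w (e i)
  simpa using this.symm

end Transfer

/-! ### Ranks of exchangeable points -/

section Rank

lemma ae_injective_pi {ι : Type*} [Fintype ι] (m : Measure ℝ) [IsProbabilityMeasure m]
    [NullSingletonClass m] : ∀ᵐ w ∂Measure.pi (fun _ : ι => m), Function.Injective w := by
  have h : ∀ i j : ι, i ≠ j → ∀ᵐ w ∂Measure.pi (fun _ : ι => m), w i ≠ w j := by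
    intro i j hij
    have hind : IndepFun (fun w : ι → ℝ => w i) (fun w => w j) (Measure.pi fun _ => m) :=
      (iIndepFun_pi (μ := fun _ : ι => m) (X := fun _ => id)
        fun _ => measurable_id.aemeasurable).indepFun hij
    rw [indepFun_iff_map_prod_eq_prod_map_map (measurable_pi_apply i).aemeasurable
      (measurable_pi_apply j).aemeasurable,
      (measurePreserving_eval (fun _ : ι => m) i).map_eq,
      (measurePreserving_eval (fun _ : ι => m) j).map_eq] at hind
    have hs : MeasurableSet {p : ℝ × ℝ | p.1 = p.2} :=
      measurableSet_eq_fun measurable_fst measurable_snd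
    have h0 : (m.prod m) {p : ℝ × ℝ | p.1 = p.2} = 0 := by
      rw [Measure.measure_prod_null hs]
      refine ae_of_all _ fun x => ?_
      have : Prod.mk x ⁻¹' {p : ℝ × ℝ | p.1 = p.2} = {x} := by ext y; simp [eq_comm]
      simp [this]
    rw [← hind, Measure.map_apply (by fun_prop) hs] at h0
    exact measure_eq_zero_iff_ae_notMem.1 h0
  have h' : ∀ᵐ w ∂Measure.pi (fun _ : ι => m), ∀ i j : ι, i ≠ j → w i ≠ w j := by
    simp only [ae_all_iff]
    exact h
  filter_upwards [h'] with w hw i j hij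
  by_contra hne
  exact hw i j hne hij

lemma cnt_lt_cnt {ι : Type*} [Fintype ι] {w : ι → ℝ} {i : ι} {x : ℝ} (h : w i < x) :
    cnt w (w i) < cnt w x := by
  refine Finset.card_lt_card ⟨fun l => by simpa using fun hl => hl.trans h, fun hsub => ?_⟩
  have := hsub (show i ∈ _ by simpa using h)
  simp at this

lemma injective_rank {ι : Type*} [Fintype ι] {w : ι → ℝ} (hw : Function.Injective w) :
    Function.Injective fun i => cnt w (w i) := by
  intro i j hij
  rcases lt_trichotomy (w i) (w j) with h | h | h
  · exact absurd hij (cnt_lt_cnt h).ne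
  · exact hw h
  · exact absurd hij (cnt_lt_cnt h).ne'

lemma exists_rank_eq {ι : Type*} [Fintype ι] {w : ι → ℝ} (hw : Function.Injective w) {s : ℕ}
    (hs : s < Fintype.card ι) : ∃ i, cnt w (w i) = s := by
  have hlt : ∀ i, cnt w (w i) < Fintype.card ι := fun i => by
    refine Finset.card_lt_univ_of_notMem (x := i) ?_
    simp
  let f : ι → Fin (Fintype.card ι) := fun i => ⟨cnt w (w i), hlt i⟩
  have hf : Function.Injective f := fun i j hij => injective_rank hw (congrArg Fin.val hij)
  have hb := (Fintype.bijective_iff_injective_and_card f).2 ⟨hf, by simp⟩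
  obtain ⟨i, hi⟩ := hb.2 ⟨s, hs⟩
  exact ⟨i, congrArg Fin.val hi⟩

lemma measurable_rank {ι : Type*} [Fintype ι] (i : ι) :
    Measurable fun w : ι → ℝ => cnt w (w i) :=
  Measurable.cnt measurable_id (measurable_pi_apply i)

/-- The rank of a given coordinate is uniform and independent of every symmetric function: all
coordinates play the same role, and almost surely exactly one of them has rank `s`. -/
lemma card_mul_lintegral_rank_eq {ι : Type*} [Fintype ι] (m : Measure ℝ)
    [IsProbabilityMeasure m] [NullSingletonClass m] {F : (ι → ℝ) → ℝ≥0∞} (hF : Measurable F)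
    (hsymm : ∀ (w : ι → ℝ) (e : Equiv.Perm ι), F (w ∘ e) = F w) (i : ι) {s : ℕ}
    (hs : s < Fintype.card ι) :
    Fintype.card ι * ∫⁻ w, {w : ι → ℝ | cnt w (w i) = s}.indicator F w ∂Measure.pi (fun _ => m)
      = ∫⁻ w, F w ∂Measure.pi (fun _ => m) := by
  classical
  have hmeas : ∀ j : ι, Measurable ({w : ι → ℝ | cnt w (w j) = s}.indicator F) := fun j =>
    hF.indicator (measurable_rank j (measurableSet_singleton s))
  have hj : ∀ j : ι,
      ∫⁻ w, {w : ι → ℝ | cnt w (w j) = s}.indicator F w ∂Measure.pi (fun _ => m)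
        = ∫⁻ w, {w : ι → ℝ | cnt w (w i) = s}.indicator F w ∂Measure.pi (fun _ => m) := by
    intro j
    rw [← lintegral_pi_comp_perm m (Equiv.swap i j) (hmeas j)]
    refine lintegral_congr fun w => ?_
    simp [indicator_apply, hsymm, cnt_comp_perm]
  calc _ = ∑ j : ι,
        ∫⁻ w, {w : ι → ℝ | cnt w (w j) = s}.indicator F w ∂Measure.pi (fun _ => m) := by
        simp [hj]
    _ = ∫⁻ w, ∑ j : ι, {w : ι → ℝ | cnt w (w j) = s}.indicator F w ∂Measure.pi (fun _ => m) :=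
        (lintegral_finsetSum _ fun j _ => hmeas j).symm
    _ = _ := by
        refine lintegral_congr_ae ?_
        filter_upwards [ae_injective_pi m] with w hw
        obtain ⟨j, hj⟩ := exists_rank_eq hw hs
        rw [Finset.sum_eq_single j]
        · simp [hj]
        · intro l _ hl
          refine indicator_of_notMem (fun h => hl (injective_rank hw ?_)) _
          exact (show cnt w (w l) = s from h).trans hj.symm
        · simp

lemma exists_perm_comp_eq {ι J : Type*} [Finite ι] (f g : J ↪ ι) :
    ∃ e : Equiv.Perm ι, ∀ j, e (f j) = g j := by
  classical
  cases nonempty_fintype ι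
  let e₀ : {x // x ∈ range f} ≃ {x // x ∈ range g} :=
    (Equiv.ofInjective f f.injective).symm.trans (Equiv.ofInjective g g.injective)
  refine ⟨e₀.extendSubtype, fun j => ?_⟩
  rw [Equiv.extendSubtype_apply_of_mem e₀ (f j) (mem_range_self j)]
  have : (⟨f j, mem_range_self j⟩ : {x // x ∈ range f}) = Equiv.ofInjective f f.injective j := rfl
  rw [this]
  simp [e₀]

/-- The events obtained from the different embeddings have the same probability, and without ties at
most one of them can occur, since ranks determine coordinates. -/
lemma card_mul_measure_rank_le {ι J : Type*} [Fintype ι] [Fintype J] (m : Measure ℝ)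
    [IsProbabilityMeasure m] [NullSingletonClass m] (f : J ↪ ι) (a : J → ℕ) :
    Fintype.card (J ↪ ι) *
      Measure.pi (fun _ : ι => m) {w | ∀ j, cnt w (w (f j)) = a j} ≤ 1 := by
  classical
  have hset : ∀ g : J ↪ ι, MeasurableSet {w : ι → ℝ | ∀ j, cnt w (w (g j)) = a j} := fun g => by
    rw [ofPred_forall]
    exact MeasurableSet.iInter fun j => measurable_rank (g j) (measurableSet_singleton (a j))
  have hmeas : ∀ g : J ↪ ι,
      Measurable ({w : ι → ℝ | ∀ j, cnt w (w (g j)) = a j}.indicator fun _ => (1 : ℝ≥0∞)) :=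
    fun g => measurable_const.indicator (hset g)
  have hg : ∀ g : J ↪ ι, ∫⁻ w, {w : ι → ℝ | ∀ j, cnt w (w (g j)) = a j}.indicator
          (fun _ => (1 : ℝ≥0∞)) w ∂Measure.pi (fun _ => m)
        = Measure.pi (fun _ : ι => m) {w | ∀ j, cnt w (w (f j)) = a j} := by
    intro g
    obtain ⟨e, he⟩ := exists_perm_comp_eq g f
    rw [← lintegral_pi_comp_perm m e (hmeas g), ← lintegral_indicator_one (hset f)]
    refine lintegral_congr fun w => ?_
    simp [indicator_apply, he, cnt_comp_perm]
  calc _ = ∑ g : J ↪ ι, ∫⁻ w, {w : ι → ℝ | ∀ j, cnt w (w (g j)) = a j}.indicator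
          (fun _ => (1 : ℝ≥0∞)) w ∂Measure.pi (fun _ => m) := by simp [hg]
    _ = ∫⁻ w, ∑ g : J ↪ ι, {w : ι → ℝ | ∀ j, cnt w (w (g j)) = a j}.indicator
          (fun _ => (1 : ℝ≥0∞)) w ∂Measure.pi (fun _ => m) :=
        (lintegral_finsetSum _ fun g _ => hmeas g).symm
    _ ≤ ∫⁻ _, 1 ∂Measure.pi (fun _ : ι => m) := by
        refine lintegral_mono_ae ?_
        filter_upwards [ae_injective_pi m] with w hw
        by_cases h : ∃ g : J ↪ ι, ∀ j, cnt w (w (g j)) = a j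
        · obtain ⟨g, hg⟩ := h
          rw [Finset.sum_eq_single g]
          · exact indicator_le_self' (by simp) _
          · intro l _ hl
            refine indicator_of_notMem (fun h => hl ?_) _
            ext j
            exact injective_rank hw ((h j).trans (hg j).symm)
          · simp
        · push Not at h
          rw [Finset.sum_eq_zero]
          · simp
          · intro g _
            refine indicator_of_notMem (fun hmem => ?_) _
            obtain ⟨j, hj⟩ := h g
            exact hj (hmem j)
    _ = 1 := by simp

end Rank

/-! ### Number of observations in a fixed set -/

section Hits

lemma hits_mono {n : ℕ} {A B : Set ℝ} (h : A ⊆ B) (x : Fin n → ℝ) : hits A x ≤ hits B x :=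
  Finset.sum_le_sum fun _ _ => indicator_le_indicator_of_subset h (by simp) _

lemma hits_cons {n : ℕ} (A : Set ℝ) (x : ℝ) (u : Fin n → ℝ) :
    hits A (Fin.cons x u : Fin (n + 1) → ℝ) = A.indicator (fun _ => 1) x + hits A u := by
  simp [hits, Fin.sum_univ_succ]

lemma hits_comp_perm {n : ℕ} (A : Set ℝ) (x : Fin n → ℝ) (e : Equiv.Perm (Fin n)) :
    hits A (x ∘ e) = hits A x :=
  Equiv.sum_comp e fun i => A.indicator (fun _ => 1) (x i)

lemma measurable_hits {n : ℕ} {A : Set ℝ} (hA : MeasurableSet A) :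
    Measurable fun x : Fin n → ℝ => hits A x :=
  Finset.measurable_fun_sum _ fun i _ =>
    (measurable_const.indicator hA).comp (measurable_pi_apply i)

/-- Add one more point to the sample. Among the n + 1 exchangeable points, the shares 1_A(w i) /
hits sum to at most 1, so each has mean at most 1/(n + 1). When the extra point lies in A, the total
count is 1 plus the count of the original sample. -/
lemma lintegral_inv_hits_add_one_le {n : ℕ} (D : Measure ℝ) [IsProbabilityMeasure D] {A : Set ℝ}
    (hA : MeasurableSet A) :
    ∫⁻ x : Fin n → ℝ, ((hits A x : ℝ≥0∞) + 1)⁻¹ ∂Measure.pi (fun _ => D)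
      ≤ (((n : ℝ≥0∞) + 1) * D A)⁻¹ := by
  let G : Fin (n + 1) → (Fin (n + 1) → ℝ) → ℝ≥0∞ := fun i w =>
    A.indicator (fun _ => 1) (w i) * (hits A w : ℝ≥0∞)⁻¹
  have hG : ∀ i, Measurable (G i) := fun i =>
    ((measurable_const.indicator hA).comp (measurable_pi_apply i)).mul
      (measurable_from_nat.comp (measurable_hits hA)).inv
  have h0 : ∀ i, ∫⁻ w, G i w ∂Measure.pi (fun _ => D) = ∫⁻ w, G 0 w ∂Measure.pi (fun _ => D) := by
    intro i
    rw [← lintegral_pi_comp_perm D (Equiv.swap 0 i) (hG i)]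
    refine lintegral_congr fun w => ?_
    simp [G, hits_comp_perm]
  have hsum : ((n : ℝ≥0∞) + 1) * ∫⁻ w, G 0 w ∂Measure.pi (fun _ => D) ≤ 1 := by
    calc _ = ∑ i, ∫⁻ w, G i w ∂Measure.pi (fun _ => D) := by simp [h0]
      _ = ∫⁻ w, ∑ i, G i w ∂Measure.pi (fun _ => D) :=
          (lintegral_finsetSum _ fun i _ => hG i).symm
      _ ≤ ∫⁻ _, 1 ∂Measure.pi (fun _ : Fin (n + 1) => D) := by
          refine lintegral_mono fun w => ?_
          have : ((hits A w : ℕ) : ℝ≥0∞) = ∑ i, A.indicator (fun _ => 1) (w i) := by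
            rw [hits, Nat.cast_sum]
            refine Finset.sum_congr rfl fun i _ => ?_
            by_cases h : w i ∈ A <;> simp [h]
          simp only [G, ← Finset.sum_mul, ← this]
          exact ENNReal.mul_inv_le_one _
      _ = 1 := by simp
  have hsplit : ∫⁻ w, G 0 w ∂Measure.pi (fun _ => D)
      = D A * ∫⁻ x : Fin n → ℝ, ((hits A x : ℝ≥0∞) + 1)⁻¹ ∂Measure.pi (fun _ => D) := by
    rw [lintegral_pi_fin_succ D (hG 0), mul_comm, ← lintegral_indicator_one hA,
      ← lintegral_const_mul _ (measurable_one.indicator hA)]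
    refine lintegral_congr fun x => ?_
    by_cases h : x ∈ A
    · simp [G, h, hits_cons, add_comm]
    · simp [G, h]
  rw [ENNReal.le_inv_iff_mul_le]
  calc _ = ((n : ℝ≥0∞) + 1) * (D A *
        ∫⁻ x : Fin n → ℝ, ((hits A x : ℝ≥0∞) + 1)⁻¹ ∂Measure.pi (fun _ => D)) := by ring
    _ ≤ 1 := by rw [← hsplit]; exact hsum

lemma lintegral_pi_prod {n : ℕ} (D : Measure ℝ) [IsProbabilityMeasure D] {φ : ℝ → ℝ≥0∞}
    (hφ : Measurable φ) :
    ∫⁻ x : Fin n → ℝ, ∏ i, φ (x i) ∂Measure.pi (fun _ => D) = ∏ _i : Fin n, ∫⁻ x, φ x ∂D := by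
  have hm : ∀ d : ℕ, Measurable fun x : Fin d → ℝ => ∏ i, φ (x i) := fun d =>
    Finset.measurable_fun_prod _ fun i _ => hφ.comp (measurable_pi_apply i)
  induction n with
  | zero => simp
  | succ d ih =>
    rw [lintegral_pi_fin_succ D (hm (d + 1)), Fin.prod_univ_succ, ← ih,
      ← lintegral_mul_const _ hφ]
    refine lintegral_congr fun x => ?_
    simp only [Fin.prod_univ_succ, Fin.cons_zero, Fin.cons_succ]
    exact lintegral_const_mul _ (hm d)

/-- A Chernoff bound: the indicator of N < K is at most 2 ^ K · 2 ^ (-N), and each factor of 2 ^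
(-N) has mean 1 - D(A)/2 ≤ exp(-D(A)/2). -/
lemma measure_hits_lt_le {n : ℕ} (D : Measure ℝ) [IsProbabilityMeasure D] {A : Set ℝ}
    (hA : MeasurableSet A) (K : ℕ) :
    Measure.pi (fun _ : Fin n => D) {x | hits A x < K}
      ≤ 2 ^ K * ENNReal.ofReal (Real.exp (-(n * D.real A / 2))) := by
  let φ : ℝ → ℝ≥0∞ := fun x => A.indicator (fun _ => 2⁻¹) x + Aᶜ.indicator (fun _ => 1) x
  have hφm : Measurable φ :=
    (measurable_const.indicator hA).add (measurable_const.indicator hA.compl)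
  have hφ : ∫⁻ x, φ x ∂D ≤ ENNReal.ofReal (Real.exp (-(D.real A / 2))) := by
    have h1 : ∫⁻ x, φ x ∂D = ENNReal.ofReal (1 - D.real A / 2) := by
      rw [lintegral_add_left (measurable_const.indicator hA), lintegral_indicator_const hA,
        lintegral_indicator_const hA.compl, one_mul, ← ofReal_measureReal (μ := D) (s := A),
        ← ofReal_measureReal (μ := D) (s := Aᶜ), probReal_compl_eq_one_sub hA]
      have h2 : (2⁻¹ : ℝ≥0∞) = ENNReal.ofReal 2⁻¹ := by
        rw [ENNReal.ofReal_inv_of_pos two_pos]; simp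
      have h3 : D.real A ≤ 1 := measureReal_le_one
      rw [h2, ← ENNReal.ofReal_mul (by norm_num), ← ENNReal.ofReal_add (by positivity)
        (by linarith)]
      congr 1; ring
    rw [h1]
    refine ENNReal.ofReal_le_ofReal ?_
    have := Real.add_one_le_exp (-(D.real A / 2))
    linarith
  have hpt : ∀ x : Fin n → ℝ,
      {x : Fin n → ℝ | hits A x < K}.indicator (fun _ => (1 : ℝ≥0∞)) x ≤ 2 ^ K * ∏ i, φ (x i) := by
    intro x
    have hprod : ∏ i, φ (x i) = (2 ^ hits A x)⁻¹ := by
      rw [hits, ← Finset.prod_pow_eq_pow_sum, ENNReal.prod_inv_distrib]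
      · refine Finset.prod_congr rfl fun i _ => ?_
        by_cases h : x i ∈ A <;> simp [φ, h]
      · intro i _ j _ _
        left
        by_cases h : x i ∈ A <;> simp [h]
    by_cases h : hits A x < K
    · rw [hprod, indicator_of_mem (show x ∈ {x : Fin n → ℝ | hits A x < K} from h),
        ← div_eq_mul_inv, ENNReal.le_div_iff_mul_le (by simp) (by simp), one_mul]
      exact pow_le_pow_right₀ (by norm_num) h.le
    · simp [h]
  have hset : MeasurableSet {x : Fin n → ℝ | hits A x < K} := measurable_hits hA measurableSet_Iio
  calc _ = ∫⁻ x, {x : Fin n → ℝ | hits A x < K}.indicator (fun _ => (1 : ℝ≥0∞)) x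
        ∂Measure.pi (fun _ : Fin n => D) := (lintegral_indicator_one hset).symm
    _ ≤ ∫⁻ x, 2 ^ K * ∏ i, φ (x i) ∂Measure.pi (fun _ : Fin n => D) := lintegral_mono hpt
    _ = 2 ^ K * ∏ _i : Fin n, ∫⁻ x, φ x ∂D := by
        have hm : Measurable fun x : Fin n → ℝ => ∏ i, φ (x i) :=
          Finset.measurable_fun_prod _ fun i _ => hφm.comp (measurable_pi_apply i)
        rw [lintegral_const_mul _ hm, lintegral_pi_prod D hφm]
    _ ≤ 2 ^ K * ∏ _i : Fin n, ENNReal.ofReal (Real.exp (-(D.real A / 2))) := by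
        gcongr
    _ = _ := by
        rw [Finset.prod_const, Finset.card_univ, Fintype.card_fin,
          ← ENNReal.ofReal_pow (Real.exp_nonneg _), ← Real.exp_nat_mul]
        congr 3; ring

end Hits

/-! ### Gaps between uniform points -/

section Levels

/-- The uniform distribution on `[0, 1]`. -/
abbrev unif : Measure ℝ := volume.restrict (Icc 0 1)

instance : IsProbabilityMeasure unif := ⟨by simp⟩

lemma cnt_cons {d : ℕ} (x : ℝ) (u : Fin d → ℝ) (y : ℝ) :
    cnt (Fin.cons x u : Fin (d + 1) → ℝ) y = (if x < y then 1 else 0) + cnt u y := by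
  simp only [cnt, Finset.card_filter, Fin.sum_univ_succ, Fin.cons_zero, Fin.cons_succ]

lemma measurableSet_cnt {ι : Type*} [Fintype ι] (u : ι → ℝ) (S : Set ℕ) :
    MeasurableSet {y | cnt u y ∈ S} :=
  (Measurable.cnt measurable_const measurable_id) (MeasurableSet.of_discrete (s := S))

lemma measurableSet_level {ι : Type*} [Fintype ι] (u : ι → ℝ) (r : ℕ) :
    MeasurableSet {y | cnt u y = r} :=
  measurableSet_cnt u {r}

lemma measurableSet_block {ι : Type*} [Fintype ι] (u : ι → ℝ) (t : ℝ) :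
    MeasurableSet (block u t) :=
  measurableSet_cnt u {cnt u t}

lemma measurable_measure_cnt {ι : Type*} [Fintype ι] (D : Measure ℝ) [SFinite D] (S : Set ℕ) :
    Measurable fun u : ι → ℝ => D {y | cnt u y ∈ S} :=
  measurable_measure_prodMk_left
    (measurable_cnt (MeasurableSet.of_discrete (s := S)) :
      MeasurableSet {p : (ι → ℝ) × ℝ | cnt p.1 p.2 ∈ S})

lemma measurable_measure_block {ι : Type*} [Fintype ι] (D : Measure ℝ) [SFinite D] :
    Measurable fun p : (ι → ℝ) × ℝ => D (block p.1 p.2) := by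
  refine measurable_measure_prodMk_left (s := {q : ((ι → ℝ) × ℝ) × ℝ | q.2 ∈ block q.1.1 q.1.2}) ?_
  exact measurableSet_eq_fun (Measurable.cnt (by fun_prop) (by fun_prop))
    (Measurable.cnt (by fun_prop) (by fun_prop))

lemma lintegral_eq_sum_level {ι : Type*} [Fintype ι] (D : Measure ℝ) (u : ι → ℝ)
    (f : ℝ → ℝ≥0∞) :
    ∫⁻ t, f t ∂D = ∑ r ∈ Finset.range (Fintype.card ι + 1), ∫⁻ t in {y | cnt u y = r}, f t ∂D := by
  rw [← lintegral_biUnion_finset _ fun r _ => measurableSet_level u r]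
  · rw [← setLIntegral_univ]
    congr 2
    ext t
    simp [cnt_le]
  · intro r _ s _ hrs
    exact disjoint_left.2 fun y hy hy' => hrs (hy.symm.trans hy')

lemma setLIntegral_level_inv_le_one {ι : Type*} [Fintype ι] (D : Measure ℝ) (u : ι → ℝ) (r : ℕ) :
    ∫⁻ t in {y | cnt u y = r}, (D (block u t))⁻¹ ∂D ≤ 1 := by
  rw [setLIntegral_congr_fun (measurableSet_level u r)
    (g := fun _ => (D {y | cnt u y = r})⁻¹)
    (fun t ht => by rw [block, show cnt u t = r from ht]),
    setLIntegral_const]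
  exact ENNReal.inv_mul_le_one _

/-- The integrand is constant on each of the card + 1 level sets, which therefore contribute at most
1 each. -/
lemma lintegral_inv_block_le {ι : Type*} [Fintype ι] (D : Measure ℝ) (u : ι → ℝ) :
    ∫⁻ t, (D (block u t))⁻¹ ∂D ≤ Fintype.card ι + 1 := by
  rw [lintegral_eq_sum_level D u]
  calc _ ≤ ∑ _r ∈ Finset.range (Fintype.card ι + 1), (1 : ℝ≥0∞) :=
        Finset.sum_le_sum fun r _ => setLIntegral_level_inv_le_one D u r
    _ = _ := by simp

/-- The points with at least `r` and at most `r + 2` splitting points below them. -/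
def mid {ι : Type*} [Fintype ι] (u : ι → ℝ) (r : ℕ) : Set ℝ := {y | cnt u y ∈ Icc r (r + 2)}

/-- The length of gap `s` is the probability that a new uniform point falls there, that is, has rank
`s` among d + 1 points. The new point splits three gaps into four, whose total length is symmetric
in all points. The right-hand side is thus free of `s`: the three gaps have equal mean shares. -/
lemma card_mul_lintegral_level_div_mid {d r s : ℕ} (hs : s ∈ Icc r (r + 2)) (hr : r + 2 ≤ d) :
    ((d : ℝ≥0∞) + 1) *
        ∫⁻ u : Fin d → ℝ, unif {y | cnt u y = s} * (unif (mid u r))⁻¹ ∂Measure.pi (fun _ => unif)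
      = ∫⁻ w : Fin (d + 1) → ℝ, (unif {y | cnt w y ∈ Icc r (r + 3)})⁻¹
          ∂Measure.pi (fun _ => unif) := by
  set g : (Fin (d + 1) → ℝ) → ℝ≥0∞ := fun w => (unif {y | cnt w y ∈ Icc r (r + 3)})⁻¹ with hg
  have hgm : Measurable g := (measurable_measure_cnt unif (Icc r (r + 3))).inv
  have h := card_mul_lintegral_rank_eq unif hgm
    (fun w e => by simp only [hg, cnt_comp_perm]) 0 (s := s)
    (by rw [Fintype.card_fin]; have := hs.2; omega)
  have hrank : MeasurableSet {w : Fin (d + 1) → ℝ | cnt w (w 0) = s} :=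
    measurable_rank 0 (measurableSet_singleton s)
  rw [← h, Fintype.card_fin, lintegral_pi_fin_succ unif (hgm.indicator hrank)]
  push_cast
  congr 1
  have hset : MeasurableSet {p : ℝ × (Fin d → ℝ) | cnt p.2 p.1 = s} :=
    (Measurable.cnt measurable_snd measurable_fst) (measurableSet_singleton s)
  have hmeas : Measurable fun p : ℝ × (Fin d → ℝ) =>
      {p : ℝ × (Fin d → ℝ) | cnt p.2 p.1 = s}.indicator (fun p => (unif (mid p.2 r))⁻¹) p :=
    (((measurable_measure_cnt unif (Icc r (r + 2))).comp measurable_snd).inv).indicator hset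
  have hswap := lintegral_lintegral_swap (μ := unif) (ν := Measure.pi fun _ : Fin d => unif)
    (f := fun x u => {p : ℝ × (Fin d → ℝ) | cnt p.2 p.1 = s}.indicator
      (fun p => (unif (mid p.2 r))⁻¹) (x, u)) hmeas.aemeasurable
  calc _ = ∫⁻ u : Fin d → ℝ, ∫⁻ x, {p : ℝ × (Fin d → ℝ) | cnt p.2 p.1 = s}.indicator
          (fun p => (unif (mid p.2 r))⁻¹) (x, u) ∂unif ∂Measure.pi (fun _ => unif) := by
        refine lintegral_congr fun u => ?_
        rw [mul_comm, ← lintegral_indicator_const (measurableSet_level u s)]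
        rfl
    _ = _ := by
        rw [← hswap]
        refine lintegral_congr fun x => lintegral_congr fun u => ?_
        simp only [indicator_apply, mem_ofPred_eq, Fin.cons_zero, cnt_cons, lt_self_iff_false,
          if_false, zero_add]
        -- With `s` points below `x`, every `y` above `x` gains one in the count, and no other `y`
        -- does. As `s` lies in [r, r + 2], the window [r, r + 2] becomes exactly [r, r + 3].
        split_ifs with hx
        · congr 2
          ext y
          simp only [mid, cnt_cons, mem_ofPred_eq, mem_Icc]
          rw [← hx] at hs
          have h1 := hs.1
          have h2 := hs.2
          by_cases hxy : x < y
          · have := cnt_mono u hxy.le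
            simp only [hxy, if_true]
            omega
          · have := cnt_mono u (not_lt.1 hxy)
            simp only [hxy, if_false]
            omega
        · rfl

lemma measure_mid {ι : Type*} [Fintype ι] (D : Measure ℝ) (u : ι → ℝ) (r : ℕ) :
    D (mid u r) = D {y | cnt u y = r} + D {y | cnt u y = r + 1} + D {y | cnt u y = r + 2} := by
  rw [← measure_union _ (measurableSet_level u (r + 1)),
    ← measure_union _ (measurableSet_level u (r + 2))]
  · congr 1
    ext y
    simp only [mid, mem_ofPred_eq, mem_Icc, mem_union]
    omega
  · refine disjoint_left.2 fun y hy hy' => ?_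
    simp only [mem_ofPred_eq, mem_union] at hy hy'
    omega
  · refine disjoint_left.2 fun y hy hy' => ?_
    simp only [mem_ofPred_eq] at hy hy'
    omega

/-- The three mean shares are equal and sum to at most 1. -/
lemma lintegral_level_div_mid_le {d r : ℕ} (hr : r + 2 ≤ d) :
    ∫⁻ u : Fin d → ℝ, unif {y | cnt u y = r + 1} * (unif (mid u r))⁻¹ ∂Measure.pi (fun _ => unif)
      ≤ 3⁻¹ := by
  set T : ℕ → ℝ≥0∞ := fun s => ∫⁻ u : Fin d → ℝ, unif {y | cnt u y = s} * (unif (mid u r))⁻¹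
    ∂Measure.pi (fun _ => unif) with hT
  have hm : ∀ s, Measurable fun u : Fin d → ℝ => unif {y | cnt u y = s} * (unif (mid u r))⁻¹ :=
    fun s => (measurable_measure_cnt unif {s}).mul (measurable_measure_cnt unif _).inv
  have heq : ∀ s ∈ Icc r (r + 2), T s = T (r + 1) := fun s hs => by
    have := (card_mul_lintegral_level_div_mid hs hr).trans
      (card_mul_lintegral_level_div_mid (d := d) (r := r) (s := r + 1) (by simp) hr).symm
    exact (ENNReal.mul_right_inj (by simp) (by simp)).1 this
  have hsum : T r + T (r + 1) + T (r + 2) ≤ 1 := by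
    simp only [hT]
    rw [← lintegral_add_left (hm r), ← lintegral_add_right _ (hm (r + 2))]
    calc _ ≤ ∫⁻ _ : Fin d → ℝ, 1 ∂Measure.pi (fun _ => unif) := by
          refine lintegral_mono fun u => ?_
          rw [← add_mul, ← add_mul, ← measure_mid]
          exact ENNReal.mul_inv_le_one _
      _ = 1 := by simp
  rw [heq r (by simp), heq (r + 2) (by simp)] at hsum
  change T (r + 1) ≤ 3⁻¹
  rw [ENNReal.le_inv_iff_mul_le]
  calc _ = T (r + 1) + T (r + 1) + T (r + 1) := by ring
    _ ≤ 1 := hsum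

end Levels

/-! ### Union of the cells of a point in two partitions -/

section TwoPartitions

/-- The first half of a family of `k + k` splitting points. -/
def fstHalf {k : ℕ} (u : Fin (k + k) → ℝ) : Fin k → ℝ := fun j => u (Fin.castAdd k j)

/-- The second half of a family of `k + k` splitting points. -/
def sndHalf {k : ℕ} (u : Fin (k + k) → ℝ) : Fin k → ℝ := fun j => u (Fin.natAdd k j)

/-- The union of the cells of `t` in the two partitions given by the two halves of `u`. -/
def wide {k : ℕ} (u : Fin (k + k) → ℝ) (t : ℝ) : Set ℝ :=
  block (fstHalf u) t ∪ block (sndHalf u) t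

lemma cnt_eq_add {k : ℕ} (u : Fin (k + k) → ℝ) (y : ℝ) :
    cnt u y = cnt (fstHalf u) y + cnt (sndHalf u) y := by
  simp only [cnt, Finset.card_filter, Fin.sum_univ_add]
  rfl

lemma measurableSet_wide {k : ℕ} (u : Fin (k + k) → ℝ) (t : ℝ) : MeasurableSet (wide u t) :=
  (measurableSet_block _ _).union (measurableSet_block _ _)

lemma measurable_fstHalf {k : ℕ} : Measurable (fstHalf (k := k)) :=
  measurable_pi_lambda _ fun _ => measurable_pi_apply _

lemma measurable_sndHalf {k : ℕ} : Measurable (sndHalf (k := k)) :=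
  measurable_pi_lambda _ fun _ => measurable_pi_apply _

lemma measurableSet_mem_wide {k : ℕ} :
    MeasurableSet {q : ((Fin (k + k) → ℝ) × ℝ) × ℝ | q.2 ∈ wide q.1.1 q.1.2} :=
  (measurableSet_eq_fun
      (Measurable.cnt (measurable_fstHalf.comp (by fun_prop)) (by fun_prop))
      (Measurable.cnt (measurable_fstHalf.comp (by fun_prop)) (by fun_prop))).union
    (measurableSet_eq_fun
      (Measurable.cnt (measurable_sndHalf.comp (by fun_prop)) (by fun_prop))
      (Measurable.cnt (measurable_sndHalf.comp (by fun_prop)) (by fun_prop)))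

lemma measurable_measure_wide {k : ℕ} (D : Measure ℝ) [SFinite D] :
    Measurable fun p : (Fin (k + k) → ℝ) × ℝ => D (wide p.1 p.2) :=
  measurable_measure_prodMk_left measurableSet_mem_wide

/-- The pooled point that ends the gap of `t` on one side belongs to only one half, so the cell of
the other half reaches across it into the next gap. In terms of counts: both are monotone and their
sum changes by at most 1, so one of them does not change. -/
lemma mid_subset_wide {k r : ℕ} {u : Fin (k + k) → ℝ} {t : ℝ} (ht : cnt u t = r + 1) :
    mid u r ⊆ wide u t := by
  intro y hy
  simp only [mid, mem_ofPred_eq, mem_Icc, cnt_eq_add] at hy ht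
  simp only [wide, block, mem_union, mem_ofPred_eq]
  rcases le_total y t with h | h
  · have h1 := cnt_mono (fstHalf u) h
    have h2 := cnt_mono (sndHalf u) h
    omega
  · have h1 := cnt_mono (fstHalf u) h
    have h2 := cnt_mono (sndHalf u) h
    omega

lemma block_subset_wide {k : ℕ} (u : Fin (k + k) → ℝ) (t : ℝ) : block u t ⊆ wide u t := by
  intro y hy
  simp only [block, mem_ofPred_eq, cnt_eq_add] at hy
  simp only [wide, block, mem_union, mem_ofPred_eq]
  rcases le_total y t with h | h
  · have h1 := cnt_mono (fstHalf u) h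
    have h2 := cnt_mono (sndHalf u) h
    omega
  · have h1 := cnt_mono (fstHalf u) h
    have h2 := cnt_mono (sndHalf u) h
    omega

lemma lintegral_inv_wide_le (k : ℕ) :
    ∫⁻ u : Fin (k + k) → ℝ, ∫⁻ t, (unif (wide u t))⁻¹ ∂unif ∂Measure.pi (fun _ => unif)
      ≤ (2 * k + 7) / 3 := by
  have hm : ∀ r, Measurable fun u : Fin (k + k) → ℝ =>
      ∫⁻ t in {y | cnt u y = r}, (unif (wide u t))⁻¹ ∂unif := fun r => by
    have hs := fun u : Fin (k + k) → ℝ => measurableSet_level u r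
    simp_rw [← lintegral_indicator (hs _)]
    have h : Measurable fun p : (Fin (k + k) → ℝ) × ℝ =>
        {p : (Fin (k + k) → ℝ) × ℝ | cnt p.1 p.2 = r}.indicator
          (fun p => (unif (wide p.1 p.2))⁻¹) p :=
      (measurable_measure_wide unif).inv.indicator
        (measurable_cnt (measurableSet_singleton r))
    exact h.lintegral_prod_right'
  have hone : ∀ (r : ℕ) (u : Fin (k + k) → ℝ),
      ∫⁻ t in {y | cnt u y = r}, (unif (wide u t))⁻¹ ∂unif ≤ 1 := fun r u =>
    (lintegral_mono fun t => ENNReal.inv_le_inv.2 (measure_mono (block_subset_wide u t))).trans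
      (setLIntegral_level_inv_le_one unif u r)
  calc _ = ∑ r ∈ Finset.range (k + k + 1), ∫⁻ u : Fin (k + k) → ℝ,
          ∫⁻ t in {y | cnt u y = r}, (unif (wide u t))⁻¹ ∂unif ∂Measure.pi (fun _ => unif) := by
        rw [← lintegral_finsetSum _ fun r _ => hm r]
        refine lintegral_congr fun u => ?_
        rw [lintegral_eq_sum_level unif u, Fintype.card_fin]
    _ ≤ ∑ r ∈ Finset.range (k + k + 1),
          ((3 : ℝ≥0∞)⁻¹ + ((if r = 0 then 1 else 0) + (if r = k + k then 1 else 0))) := by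
        refine Finset.sum_le_sum fun r hr => ?_
        rw [Finset.mem_range] at hr
        -- The two extreme pooled gaps lack a neighbour and get the trivial bound 1; every other gap
        -- gets 1/3. Hence (2k + 1)/3 + 2 in total.
        by_cases hr' : r = 0 ∨ r = k + k
        · have h1 : (1 : ℝ≥0∞) ≤ (if r = 0 then 1 else 0) + (if r = k + k then 1 else 0) := by
            rcases hr' with h | h
            · rw [if_pos h]; exact le_self_add
            · rw [if_pos h]; exact le_add_self
          calc _ ≤ ∫⁻ _ : Fin (k + k) → ℝ, 1 ∂Measure.pi (fun _ => unif) :=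
                lintegral_mono fun u => hone r u
            _ = 1 := by simp
            _ ≤ _ := h1.trans le_add_self
        · obtain ⟨s, rfl⟩ : ∃ s, r = s + 1 := ⟨r - 1, by omega⟩
          refine le_trans ?_ ((lintegral_level_div_mid_le (d := k + k) (r := s) (by omega)).trans
            le_self_add)
          refine lintegral_mono fun u => ?_
          calc _ ≤ ∫⁻ _ in {y | cnt u y = s + 1}, (unif (mid u s))⁻¹ ∂unif :=
                setLIntegral_mono measurable_const fun t ht =>
                  ENNReal.inv_le_inv.2 (measure_mono (mid_subset_wide ht))
            _ = _ := by rw [setLIntegral_const, mul_comm]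
    _ = (2 * k + 7) / 3 := by
        rw [Finset.sum_add_distrib, Finset.sum_add_distrib, Finset.sum_ite_eq', Finset.sum_ite_eq']
        simp only [Finset.mem_range, Nat.zero_lt_succ, if_true,
          Finset.sum_const, Finset.card_range, nsmul_eq_mul, lt_add_iff_pos_right, zero_lt_one]
        rw [ENNReal.div_eq_inv_mul]
        have h3 : (1 : ℝ≥0∞) + 1 = 3⁻¹ * 6 := by
          rw [show (6 : ℝ≥0∞) = 3 * 2 by norm_num, ← mul_assoc,
            ENNReal.inv_mul_cancel (by simp) (by simp)]
          norm_num
        rw [h3, mul_comm _ (3⁻¹ : ℝ≥0∞), ← mul_add]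
        congr 1
        push_cast
        ring

end TwoPartitions

/-! ### Second moment of the cell length -/

section CellLength

lemma cnt_sum {I J : Type*} [Fintype I] [Fintype J] (w : I ⊕ J → ℝ) (y : ℝ) :
    cnt w y = cnt (fun i => w (.inl i)) y + cnt (fun j => w (.inr j)) y := by
  simp only [cnt, Finset.card_filter, Fintype.sum_sum_type]

lemma measure_three_same_block_le (k : ℕ) :
    Measure.pi (fun _ : Fin k ⊕ Fin 3 => unif)
        {w | ∀ i, cnt (fun j => w (.inl j)) (w (.inr i)) = cnt (fun j => w (.inl j)) (w (.inr 0))}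
      ≤ 6 / ((k + 3) * (k + 2)) := by
  classical
  set π := Measure.pi (fun _ : Fin k ⊕ Fin 3 => unif)
  let f : Fin 3 ↪ Fin k ⊕ Fin 3 := Function.Embedding.inr
  -- Three extra points in one gap have consecutive ranks among the k + 3 points. A pattern records
  -- the number of splitting points below the gap and the order of the three points: (k + 1) · 3!
  -- patterns, each of probability at most 1/((k + 3)(k + 2)(k + 1)).
  let S : Fin (k + 1) × Equiv.Perm (Fin 3) → Set (Fin k ⊕ Fin 3 → ℝ) := fun p =>
    {w | ∀ j, cnt w (w (f j)) = p.1 + p.2 j}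
  have hS : ∀ p, π (S p) ≤ (((k + 3) * (k + 2) * (k + 1) : ℝ≥0∞))⁻¹ := fun p => by
    rw [ENNReal.le_inv_iff_mul_le, mul_comm]
    have h := card_mul_measure_rank_le unif f fun j => p.1 + p.2 j
    rw [Fintype.card_embedding_eq, Fintype.card_fin, Fintype.card_sum, Fintype.card_fin,
      Fintype.card_fin] at h
    refine le_trans (le_of_eq ?_) h
    congr 1
    simp only [Nat.descFactorial, Nat.sub_zero, Nat.cast_mul]
    rw [show k + 3 - 2 = k + 1 by omega, show k + 3 - 1 = k + 2 by omega]
    push_cast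
    ring
  have hsub : ∀ᵐ w ∂π, (∀ i, cnt (fun j => w (.inl j)) (w (.inr i))
      = cnt (fun j => w (.inl j)) (w (.inr 0))) → w ∈ ⋃ p, S p := by
    filter_upwards [ae_injective_pi unif] with w hw hsame
    set r := cnt (fun j => w (.inl j)) (w (.inr 0))
    set v : Fin 3 → ℝ := fun i => w (.inr i)
    have hr : r < k + 1 := by
      have := cnt_le (fun j => w (.inl j)) (w (.inr 0))
      rw [Fintype.card_fin] at this
      exact Nat.lt_succ_of_le this
    have hrank : ∀ j, cnt w (w (f j)) = r + cnt v (v j) := fun j => by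
      rw [cnt_sum]
      congr 1
      exact hsame j
    have hlt : ∀ j, cnt v (v j) < 3 := fun j => by
      refine (Finset.card_lt_univ_of_notMem (x := j) (by simp)).trans_eq (by simp)
    have hv : Function.Injective v := fun i j hij => f.injective (hw hij)
    let σ : Fin 3 → Fin 3 := fun j => ⟨cnt v (v j), hlt j⟩
    have hσ : Function.Bijective σ := Finite.injective_iff_bijective.1 fun i j hij =>
      injective_rank hv (congrArg Fin.val hij)
    exact mem_iUnion.2 ⟨(⟨r, hr⟩, Equiv.ofBijective σ hσ), hrank⟩
  calc _ ≤ π (⋃ p, S p) := measure_mono_ae hsub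
    _ ≤ ∑ p, π (S p) := measure_iUnion_fintype_le _ _
    _ ≤ ∑ _p : Fin (k + 1) × Equiv.Perm (Fin 3), (((k + 3) * (k + 2) * (k + 1) : ℝ≥0∞))⁻¹ :=
        Finset.sum_le_sum fun p _ => hS p
    _ = 6 / ((k + 3) * (k + 2)) := by
        have h1 : ((k : ℝ≥0∞) + 1) * ((k : ℝ≥0∞) + 1)⁻¹ = 1 :=
          ENNReal.mul_inv_cancel (by simp) (by simp)
        rw [Finset.sum_const, Finset.card_univ, Fintype.card_prod, Fintype.card_perm,
          Fintype.card_fin, Fintype.card_fin, nsmul_eq_mul, div_eq_mul_inv,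
          ENNReal.mul_inv (a := (k + 3) * (k + 2)) (by simp) (Or.inr (by simp))]
        push_cast
        calc _ = ((k : ℝ≥0∞) + 1) * ((k : ℝ≥0∞) + 1)⁻¹
              * (6 * (((k : ℝ≥0∞) + 3) * (k + 2))⁻¹) := by
              simp [Nat.factorial]; ring
          _ = _ := by rw [h1, one_mul]

/-- The squared length is the probability that two further uniform points join `t` in its cell. -/
lemma lintegral_sq_measure_block_le (k : ℕ) :
    ∫⁻ u : Fin k → ℝ, ∫⁻ t, unif (block u t) ^ 2 ∂unif ∂Measure.pi (fun _ => unif)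
      ≤ 6 / ((k + 3) * (k + 2)) := by
  set E : Set (Fin k ⊕ Fin 3 → ℝ) := {w | ∀ i, cnt (fun j => w (.inl j)) (w (.inr i))
    = cnt (fun j => w (.inl j)) (w (.inr 0))} with hE
  have hm : Measurable fun w : Fin k ⊕ Fin 3 → ℝ => fun j : Fin k => w (.inl j) :=
    measurable_pi_lambda _ fun _ => measurable_pi_apply _
  have hEm : MeasurableSet E := by
    rw [hE, ofPred_forall]
    exact MeasurableSet.iInter fun i =>
      measurableSet_eq_fun (Measurable.cnt hm (measurable_pi_apply _))
        (Measurable.cnt hm (measurable_pi_apply _))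
  have hind : Measurable (E.indicator (1 : (Fin k ⊕ Fin 3 → ℝ) → ℝ≥0∞)) :=
    measurable_one.indicator hEm
  refine le_trans (le_of_eq ?_) (measure_three_same_block_le k)
  change _ = Measure.pi (fun _ : Fin k ⊕ Fin 3 => unif) E
  rw [← lintegral_indicator_one hEm, lintegral_pi_sum _ hind]
  refine lintegral_congr fun u => ?_
  rw [lintegral_pi_fin_succ unif
    (F := fun b => E.indicator 1 (Sum.elim u b))
    (hind.comp (measurable_sumElim.comp measurable_prodMk_left))]
  refine lintegral_congr fun t => ?_
  have h := lintegral_pi_prod (n := 2) unif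
    ((measurable_const (a := (1 : ℝ≥0∞))).indicator (measurableSet_block u t))
  rw [Finset.prod_const, lintegral_indicator_const (measurableSet_block u t), one_mul,
    Finset.card_univ, Fintype.card_fin] at h
  rw [← h]
  refine lintegral_congr fun v => ?_
  have hiff : (Sum.elim u (Fin.cons t v : Fin 3 → ℝ) ∈ E) ↔ v 0 ∈ block u t ∧ v 1 ∈ block u t := by
    have h2 : (Fin.cons t v : Fin 3 → ℝ) 2 = v 1 := rfl
    simp [hE, Fin.forall_fin_succ, block, h2]
  by_cases h0 : v 0 ∈ block u t <;> by_cases h1 : v 1 ∈ block u t <;>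
    simp [Fin.prod_univ_two, hiff, h0, h1]

end CellLength

/-! ### Probability of a short cell -/

section SmallCells

lemma measure_exists_mem_le {k : ℕ} {S : Set ℝ} (hS : MeasurableSet S) :
    Measure.pi (fun _ : Fin k => unif) {u | ∃ j, u j ∈ S} ≤ k * unif S := by
  have h : {u : Fin k → ℝ | ∃ j, u j ∈ S} = ⋃ j, Function.eval j ⁻¹' S := by ext; simp
  rw [h]
  refine (measure_iUnion_fintype_le _ _).trans ?_
  simp [(measurePreserving_eval (fun _ : Fin k => unif) _).measure_preimage
    hS.nullMeasurableSet]

lemma measure_exists_mem_and_mem_le {k : ℕ} {S S' : Set ℝ} (hS : MeasurableSet S)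
    (hS' : MeasurableSet S') (hd : Disjoint S S') :
    Measure.pi (fun _ : Fin k => unif) {u | (∃ i, u i ∈ S) ∧ ∃ j, u j ∈ S'}
      ≤ (k : ℝ≥0∞) ^ 2 * (unif S * unif S') := by
  have h : {u : Fin k → ℝ | (∃ i, u i ∈ S) ∧ ∃ j, u j ∈ S'}
      = ⋃ p : Fin k × Fin k, Function.eval p.1 ⁻¹' S ∩ Function.eval p.2 ⁻¹' S' := by
    ext; simp
  have hp : ∀ p : Fin k × Fin k, Measure.pi (fun _ : Fin k => unif)
      (Function.eval p.1 ⁻¹' S ∩ Function.eval p.2 ⁻¹' S') ≤ unif S * unif S' := by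
    rintro ⟨i, j⟩
    -- Disjointness removes the diagonal pairs, where independence is not available.
    by_cases hij : i = j
    · subst hij
      rw [← preimage_inter, hd.inter_eq]
      simp
    · have hind : IndepFun (Function.eval i) (Function.eval j)
          (Measure.pi fun _ : Fin k => unif) :=
        (iIndepFun_pi (μ := fun _ : Fin k => unif) (X := fun _ => id)
          fun _ => measurable_id.aemeasurable).indepFun hij
      rw [hind.measure_inter_preimage_eq_mul _ _ hS hS',
        (measurePreserving_eval (fun _ : Fin k => unif) i).measure_preimage hS.nullMeasurableSet,
        (measurePreserving_eval (fun _ : Fin k => unif) j).measure_preimage hS'.nullMeasurableSet]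
  rw [h]
  refine (measure_iUnion_fintype_le _ _).trans ((Finset.sum_le_sum fun p _ => hp p).trans ?_)
  simp [sq]

/-- Without a splitting point in this interval, the block would contain all of [t, t + τ]. -/
lemma exists_mem_Ico_right {k : ℕ} {u : Fin k → ℝ} {t τ : ℝ} (ht : 0 ≤ t) (h1 : t + τ ≤ 1)
    (h : unif (block u t) < ENNReal.ofReal τ) : ∃ j, u j ∈ Ico t (t + τ) := by
  by_contra! hne
  refine h.not_ge ?_
  have hsub : Icc t (t + τ) ⊆ block u t := fun y hy => by
    refine congrArg Finset.card (Finset.filter_congr fun j _ => ⟨fun hj => ?_, fun hj => ?_⟩)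
    · by_contra hj'
      exact hne j ⟨not_lt.1 hj', hj.trans_le hy.2⟩
    · exact hj.trans_le hy.1
  refine le_trans ?_ (measure_mono hsub)
  rw [Measure.restrict_apply measurableSet_Icc,
    inter_eq_left.2 (Icc_subset_Icc ht h1), Real.volume_Icc]
  simp

lemma exists_mem_Ico_left {k : ℕ} {u : Fin k → ℝ} {t τ : ℝ} (ht : t ≤ 1) (h0 : 0 ≤ t - τ)
    (h : unif (block u t) < ENNReal.ofReal τ) : ∃ j, u j ∈ Ico (t - τ) t := by
  by_contra! hne
  refine h.not_ge ?_
  have hsub : Ioc (t - τ) t ⊆ block u t := fun y hy => by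
    refine congrArg Finset.card (Finset.filter_congr fun j _ => ⟨fun hj => ?_, fun hj => ?_⟩)
    · exact hj.trans_le hy.2
    · by_contra hj'
      exact hne j ⟨hy.1.le.trans (not_lt.1 hj'), hj⟩
  refine le_trans ?_ (measure_mono hsub)
  rw [Measure.restrict_apply measurableSet_Ioc,
    inter_eq_left.2 (Ioc_subset_Icc_self.trans (Icc_subset_Icc h0 ht)), Real.volume_Ioc]
  simp

lemma unif_Ico_le (a b : ℝ) : unif (Ico a b) ≤ ENNReal.ofReal (b - a) := by
  rw [← Real.volume_Ico]
  exact Measure.restrict_apply_le _ _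

/-- A short cell has a splitting point within τ on each side of `t`, which costs (kτ)². Within τ of
an end of [0, 1] only one such point is guaranteed, costing kτ, but these `t` have measure at most τ
≤ kτ. A bound of order kτ would not do later: kτ would have to be o(k/n) while nτ tends to infinity.
-/
lemma lintegral_measure_block_lt_le {k : ℕ} (hk : 1 ≤ k) {τ : ℝ} (hτ : τ ≤ 1 / 2) :
    ∫⁻ t, Measure.pi (fun _ : Fin k => unif) {u | unif (block u t) < ENNReal.ofReal τ} ∂unif
      ≤ 3 * (k * ENNReal.ofReal τ) ^ 2 := by
  set T := ENNReal.ofReal τ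
  have hS : ∀ a b : ℝ, b - a = τ → unif (Ico a b) ≤ T := fun a b hab => by
    simpa [T, hab] using unif_Ico_le a b
  have hpt : ∀ t ∈ Icc (0 : ℝ) 1,
      Measure.pi (fun _ : Fin k => unif) {u | unif (block u t) < T} ≤
        (k : ℝ≥0∞) ^ 2 * (T * T) + ((Ico 0 τ).indicator (fun _ => k * T) t +
          (Ico (1 - τ) 1).indicator (fun _ => k * T) t) + ({1} : Set ℝ).indicator 1 t := by
    intro t ht
    by_cases h1 : t + τ ≤ 1
    · by_cases h0 : 0 ≤ t - τ
      · refine le_trans ?_ (le_self_add.trans le_self_add)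
        refine (measure_mono fun u hu => ?_).trans
          ((measure_exists_mem_and_mem_le (S := Ico (t - τ) t) (S' := Ico t (t + τ))
            measurableSet_Ico measurableSet_Ico (Ico_disjoint_Ico_same)).trans ?_)
        · exact ⟨exists_mem_Ico_left ht.2 h0 hu, exists_mem_Ico_right ht.1 h1 hu⟩
        · gcongr <;> exact hS _ _ (by ring)
      · rw [indicator_of_mem (show t ∈ Ico 0 τ from ⟨ht.1, by linarith⟩)]
        refine le_trans ?_ (((le_self_add).trans (le_add_self)).trans le_self_add)
        refine (measure_mono fun u hu => exists_mem_Ico_right ht.1 h1 hu).trans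
          ((measure_exists_mem_le measurableSet_Ico).trans ?_)
        gcongr
        exact hS _ _ (by ring)
    · rcases ht.2.eq_or_lt with rfl | ht1
      · refine le_trans ?_ le_add_self
        simp [prob_le_one]
      rw [indicator_of_mem (show t ∈ Ico (1 - τ) 1 from ⟨by linarith, by linarith⟩)]
      refine le_trans ?_ (((le_add_self).trans (le_add_self)).trans le_self_add)
      refine (measure_mono fun u hu => exists_mem_Ico_left ht.2 (by linarith) hu).trans
        ((measure_exists_mem_le measurableSet_Ico).trans ?_)
      gcongr
      exact hS _ _ (by ring)
  have hk1 : (1 : ℝ≥0∞) ≤ k := by exact_mod_cast hk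
  calc _ ≤ ∫⁻ t, ((k : ℝ≥0∞) ^ 2 * (T * T) + ((Ico 0 τ).indicator (fun _ => k * T) t +
          (Ico (1 - τ) 1).indicator (fun _ => k * T) t) +
            ({1} : Set ℝ).indicator 1 t) ∂unif :=
        setLIntegral_mono_ae' measurableSet_Icc (ae_of_all _ hpt)
    _ = (k : ℝ≥0∞) ^ 2 * (T * T) + (k * T * unif (Ico 0 τ) +
          k * T * unif (Ico (1 - τ) 1)) := by
        have m1 : Measurable ((Ico 0 τ).indicator fun _ : ℝ => k * T) :=
          measurable_const.indicator measurableSet_Ico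
        have m3 : Measurable (({1} : Set ℝ).indicator (1 : ℝ → ℝ≥0∞)) :=
          measurable_one.indicator (measurableSet_singleton 1)
        rw [lintegral_add_right _ m3, lintegral_add_left measurable_const, lintegral_add_left m1,
          lintegral_indicator_const measurableSet_Ico, lintegral_indicator_const measurableSet_Ico,
          lintegral_indicator_one (measurableSet_singleton 1), lintegral_const]
        simp
    _ ≤ (k : ℝ≥0∞) ^ 2 * (T * T) + (k * T * (k * T) + k * T * (k * T)) := by
        have h : ∀ a b : ℝ, b - a = τ → unif (Ico a b) ≤ k * T := fun a b hab =>
          (hS a b hab).trans (le_mul_of_one_le_left (zero_le) hk1)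
        gcongr <;> exact h _ _ (by ring)
    _ = _ := by ring

end SmallCells

/-! ### Comparison of the design law with the uniform law -/

section Design

lemma isProbabilityMeasure_designLaw {μ : ℝ → ℝ} (hcont : ContinuousOn μ (Icc 0 1))
    (hpos : ∀ x ∈ Icc (0 : ℝ) 1, 0 < μ x) (hint : ∫ x in (0 : ℝ)..1, μ x = 1) :
    IsProbabilityMeasure (designLaw μ) := by
  constructor
  rw [intervalIntegral.integral_of_le zero_le_one, ← integral_Icc_eq_integral_Ioc] at hint
  have hi : IntegrableOn μ (Icc 0 1) := hcont.integrableOn_Icc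
  rw [designLaw, withDensity_apply _ MeasurableSet.univ, Measure.restrict_univ,
    ← ofReal_integral_eq_lintegral_ofReal hi, hint, ENNReal.ofReal_one]
  filter_upwards [ae_restrict_mem measurableSet_Icc] with x hx using (hpos x hx).le

lemma designLaw_le {μ : ℝ → ℝ} {M : ℝ} (hle : ∀ x ∈ Icc (0 : ℝ) 1, μ x ≤ M) :
    designLaw μ ≤ ENNReal.ofReal M • unif := by
  rw [designLaw, ← withDensity_const]
  refine withDensity_mono ?_
  filter_upwards [ae_restrict_mem measurableSet_Icc] with x hx
    using ENNReal.ofReal_le_ofReal (hle x hx)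

lemma le_designLaw_apply {μ : ℝ → ℝ} {c : ℝ} {A : Set ℝ} (hA : MeasurableSet A)
    (hc : ∀ x ∈ A ∩ Icc 0 1, c ≤ μ x) :
    ENNReal.ofReal c * unif A ≤ designLaw μ A := by
  rw [designLaw, withDensity_apply _ hA, ← setLIntegral_const]
  refine setLIntegral_mono_ae' hA ?_
  filter_upwards [ae_restrict_mem measurableSet_Icc] with x hx hxA
    using ENNReal.ofReal_le_ofReal (hc x ⟨hxA, hx⟩)

lemma designLaw_absolutelyContinuous (μ : ℝ → ℝ) : designLaw μ ≪ unif :=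
  withDensity_absolutelyContinuous _ _

lemma ae_designLaw_mem (μ : ℝ → ℝ) : ∀ᵐ t ∂designLaw μ, t ∈ Ioc (0 : ℝ) 1 := by
  refine (designLaw_absolutelyContinuous μ).ae_le ?_
  have h0 : ∀ᵐ t ∂unif, t ≠ 0 := compl_mem_ae_iff.2 (measure_singleton (0 : ℝ))
  filter_upwards [ae_restrict_mem measurableSet_Icc, h0] with t ht h
    using ⟨lt_of_le_of_ne ht.1 (Ne.symm h), ht.2⟩

/-- The block is order connected, as a fibre of a monotone function, so it contains the whole
segment between `t` and `y`. -/
lemma ofReal_abs_sub_le_block {ι : Type*} [Fintype ι] {u : ι → ℝ} {t y : ℝ}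
    (ht : t ∈ Icc (0 : ℝ) 1) (hy : y ∈ Icc (0 : ℝ) 1) (h : y ∈ block u t) :
    ENNReal.ofReal |y - t| ≤ unif (block u t) := by
  have hoc : OrdConnected (block u t) := ordConnected_singleton.preimage_mono (cnt_mono u)
  have hsub : uIcc t y ⊆ block u t := hoc.uIcc_subset rfl h
  refine le_trans ?_ (measure_mono hsub)
  rw [Measure.restrict_apply measurableSet_uIcc, inter_eq_left.2 (uIcc_subset_Icc ht hy),
    Real.volume_interval]

lemma ofReal_abs_sub_le_wide {k : ℕ} {u : Fin (k + k) → ℝ} {t y : ℝ}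
    (ht : t ∈ Icc (0 : ℝ) 1) (hy : y ∈ Icc (0 : ℝ) 1) (h : y ∈ wide u t) :
    ENNReal.ofReal |y - t| ≤ unif (wide u t) := by
  rcases h with h | h
  · exact (ofReal_abs_sub_le_block ht hy h).trans (measure_mono subset_union_left)
  · exact (ofReal_abs_sub_le_block ht hy h).trans (measure_mono subset_union_right)

lemma exists_pos_le_of_continuousOn {μ : ℝ → ℝ} (hcont : ContinuousOn μ (Icc 0 1))
    (hpos : ∀ x ∈ Icc (0 : ℝ) 1, 0 < μ x) : ∃ m, 0 < m ∧ ∀ x ∈ Icc (0 : ℝ) 1, m ≤ μ x := by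
  obtain ⟨x₀, hx₀, hmin⟩ := isCompact_Icc.exists_isMinOn (nonempty_Icc.2 zero_le_one) hcont
  exact ⟨μ x₀, hpos x₀ hx₀, fun x hx => hmin hx⟩

/-- On a set of uniform measure below δ, uniform continuity gives μ ≥ (9/10) μ(t), so μ(t) cancels
up to the factor 10/9. On a longer set the design mass is at least mδ, which gives the additive
constant, independent of k. -/
lemma exists_lintegral_inv_designLaw_wide_le {μ : ℝ → ℝ} (hcont : ContinuousOn μ (Icc 0 1))
    (hpos : ∀ x ∈ Icc (0 : ℝ) 1, 0 < μ x) (hint : ∫ x in (0 : ℝ)..1, μ x = 1) :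
    ∃ c : ℝ, 0 ≤ c ∧ ∀ (k : ℕ) (u : Fin (k + k) → ℝ),
      ∫⁻ t, (designLaw μ (wide u t))⁻¹ ∂designLaw μ
        ≤ 10 / 9 * ∫⁻ t, (unif (wide u t))⁻¹ ∂unif + ENNReal.ofReal c := by
  have := isProbabilityMeasure_designLaw hcont hpos hint
  obtain ⟨m, hm, hmμ⟩ := exists_pos_le_of_continuousOn hcont hpos
  obtain ⟨δ, hδ, hδμ⟩ := Metric.uniformContinuousOn_iff.1
    (isCompact_Icc.uniformContinuousOn_of_continuous hcont) (m / 10) (by positivity)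
  refine ⟨(m * δ)⁻¹, by positivity, fun k u => ?_⟩
  have hμm : AEMeasurable (fun x => ENNReal.ofReal (μ x)) unif :=
    (hcont.aemeasurable measurableSet_Icc).ennreal_ofReal
  have hD : Measurable fun t => (designLaw μ (wide u t))⁻¹ :=
    ((measurable_measure_wide (designLaw μ)).comp measurable_prodMk_left).inv
  have hU : Measurable fun t => (unif (wide u t))⁻¹ :=
    ((measurable_measure_wide unif).comp measurable_prodMk_left).inv
  have hpt : ∀ t ∈ Icc (0 : ℝ) 1, ENNReal.ofReal (μ t) * (designLaw μ (wide u t))⁻¹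
      ≤ 10 / 9 * (unif (wide u t))⁻¹ + ENNReal.ofReal (μ t) * ENNReal.ofReal (m * δ)⁻¹ := by
    intro t ht
    have hμt := hpos t ht
    rcases lt_or_ge (unif (wide u t)) (ENNReal.ofReal δ) with h | h
    · refine le_trans ?_ le_self_add
      have hloc : ENNReal.ofReal (9 / 10 * μ t) * unif (wide u t) ≤ designLaw μ (wide u t) := by
        refine le_designLaw_apply (measurableSet_wide u t) fun y hy => ?_
        have h1 := (ofReal_abs_sub_le_wide ht hy.2 hy.1).trans_lt h
        rw [ENNReal.ofReal_lt_ofReal_iff hδ] at h1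
        have h2 := hδμ y hy.2 t ht h1
        rw [Real.dist_eq, abs_lt] at h2
        have h3 := hmμ t ht
        linarith [h2.1]
      have h109 : (10 / 9 : ℝ≥0∞) = ENNReal.ofReal (10 / 9) := by
        rw [ENNReal.ofReal_div_of_pos (by norm_num)]; simp
      calc _ ≤ ENNReal.ofReal (μ t) *
            (ENNReal.ofReal (9 / 10 * μ t) * unif (wide u t))⁻¹ := by gcongr
        _ = _ := by
          have hne : ENNReal.ofReal (9 / 10 * μ t) ≠ 0 := by
            rw [Ne, ENNReal.ofReal_eq_zero, not_le]; positivity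
          rw [ENNReal.mul_inv (Or.inl hne) (Or.inl ENNReal.ofReal_ne_top), ← mul_assoc,
            ← ENNReal.ofReal_inv_of_pos (by positivity), ← ENNReal.ofReal_mul hμt.le, h109]
          congr 2
          field_simp
    · refine le_trans ?_ le_add_self
      gcongr
      rw [ENNReal.ofReal_inv_of_pos (by positivity)]
      refine ENNReal.inv_le_inv.2 ?_
      refine le_trans ?_ (le_designLaw_apply (c := m) (measurableSet_wide u t)
        fun y hy => hmμ y hy.2)
      rw [ENNReal.ofReal_mul hm.le]
      gcongr
  have htot : ∫⁻ t, ENNReal.ofReal (μ t) ∂unif = 1 := by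
    rw [← setLIntegral_univ, ← withDensity_apply _ MeasurableSet.univ]
    exact this.measure_univ
  calc _ = ∫⁻ t, ENNReal.ofReal (μ t) * (designLaw μ (wide u t))⁻¹ ∂unif :=
        lintegral_withDensity_eq_lintegral_mul₀ hμm hD.aemeasurable
    _ ≤ ∫⁻ t, (10 / 9 * (unif (wide u t))⁻¹
          + ENNReal.ofReal (μ t) * ENNReal.ofReal (m * δ)⁻¹) ∂unif :=
        setLIntegral_mono_ae' measurableSet_Icc (ae_of_all _ hpt)
    _ = _ := by
        rw [lintegral_add_left (hU.const_mul _), lintegral_const_mul _ hU,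
          lintegral_mul_const'' _ hμm, htot, one_mul]

end Design

/-! ### Mean values over splitting points, test point and sample -/

section Averages

lemma lintegral_inv_hits_block_le (k n : ℕ) (D : Measure ℝ) [IsProbabilityMeasure D] :
    ∫⁻ u : Fin k → ℝ, ∫⁻ t, ∫⁻ x : Fin n → ℝ, ((hits (block u t) x : ℝ≥0∞) + 1)⁻¹
        ∂Measure.pi (fun _ => D) ∂D ∂Measure.pi (fun _ => unif) ≤ (k + 1) / (n + 1) := by
  have hu : ∀ u : Fin k → ℝ, ∫⁻ t, ∫⁻ x : Fin n → ℝ, ((hits (block u t) x : ℝ≥0∞) + 1)⁻¹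
      ∂Measure.pi (fun _ => D) ∂D ≤ (k + 1) / (n + 1) := fun u => by
    calc _ ≤ ∫⁻ t, ((n : ℝ≥0∞) + 1)⁻¹ * (D (block u t))⁻¹ ∂D := by
          refine lintegral_mono fun t => (lintegral_inv_hits_add_one_le D
            (measurableSet_block u t)).trans_eq ?_
          exact ENNReal.mul_inv (by simp) (by simp)
      _ = ((n : ℝ≥0∞) + 1)⁻¹ * ∫⁻ t, (D (block u t))⁻¹ ∂D :=
          lintegral_const_mul' _ _ (by simp)
      _ ≤ ((n : ℝ≥0∞) + 1)⁻¹ * (k + 1) := by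
          gcongr
          simpa using lintegral_inv_block_le D u
      _ = _ := by rw [ENNReal.div_eq_inv_mul]
  calc _ ≤ ∫⁻ _ : Fin k → ℝ, ((k + 1) / (n + 1) : ℝ≥0∞) ∂Measure.pi (fun _ => unif) :=
        lintegral_mono hu
    _ = _ := by simp

lemma exists_lintegral_inv_hits_wide_le {μ : ℝ → ℝ} (hcont : ContinuousOn μ (Icc 0 1))
    (hpos : ∀ x ∈ Icc (0 : ℝ) 1, 0 < μ x) (hint : ∫ x in (0 : ℝ)..1, μ x = 1) :
    ∃ c : ℝ, 0 ≤ c ∧ ∀ k n : ℕ,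
      ∫⁻ u : Fin (k + k) → ℝ, ∫⁻ t, ∫⁻ x : Fin n → ℝ, ((hits (wide u t) x : ℝ≥0∞) + 1)⁻¹
        ∂Measure.pi (fun _ => designLaw μ) ∂designLaw μ ∂Measure.pi (fun _ => unif)
      ≤ ENNReal.ofReal ((10 / 9 * ((2 * k + 7) / 3) + c) / (n + 1)) := by
  have := isProbabilityMeasure_designLaw hcont hpos hint
  obtain ⟨c, hc, h⟩ := exists_lintegral_inv_designLaw_wide_le hcont hpos hint
  refine ⟨c, hc, fun k n => ?_⟩
  have hU : Measurable fun u : Fin (k + k) → ℝ => ∫⁻ t, (unif (wide u t))⁻¹ ∂unif :=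
    (measurable_measure_wide unif).inv.lintegral_prod_right'
  calc _ ≤ ∫⁻ u : Fin (k + k) → ℝ, ((n : ℝ≥0∞) + 1)⁻¹ *
          (10 / 9 * ∫⁻ t, (unif (wide u t))⁻¹ ∂unif + ENNReal.ofReal c)
          ∂Measure.pi (fun _ => unif) := by
        refine lintegral_mono fun u => ?_
        calc _ ≤ ∫⁻ t, ((n : ℝ≥0∞) + 1)⁻¹ * (designLaw μ (wide u t))⁻¹ ∂designLaw μ := by
              refine lintegral_mono fun t => (lintegral_inv_hits_add_one_le _
                (measurableSet_wide u t)).trans_eq ?_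
              exact ENNReal.mul_inv (by simp) (by simp)
          _ = ((n : ℝ≥0∞) + 1)⁻¹ * ∫⁻ t, (designLaw μ (wide u t))⁻¹ ∂designLaw μ :=
              lintegral_const_mul' _ _ (by simp)
          _ ≤ _ := by gcongr; exact h k u
    _ = ((n : ℝ≥0∞) + 1)⁻¹ * (10 / 9 * ∫⁻ u : Fin (k + k) → ℝ, ∫⁻ t, (unif (wide u t))⁻¹ ∂unif
          ∂Measure.pi (fun _ => unif) + ENNReal.ofReal c) := by
        rw [lintegral_const_mul' _ _ (by simp), lintegral_add_right _ measurable_const,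
          lintegral_const_mul _ hU]
        simp
    _ ≤ ((n : ℝ≥0∞) + 1)⁻¹ * (10 / 9 * ((2 * k + 7) / 3) + ENNReal.ofReal c) := by
        gcongr
        exact lintegral_inv_wide_le k
    _ = _ := by
        rw [ENNReal.ofReal_div_of_pos (by positivity), ENNReal.ofReal_add (by positivity) hc,
          ENNReal.ofReal_mul (by positivity), ENNReal.ofReal_div_of_pos (by positivity),
          ENNReal.ofReal_div_of_pos (by positivity), ENNReal.ofReal_add (by positivity)
          (by positivity), ENNReal.ofReal_add (by positivity) (by positivity),
          ENNReal.ofReal_mul (by positivity)]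
        simp [ENNReal.div_eq_inv_mul]

lemma lintegral_sq_measure_block_designLaw_le {μ : ℝ → ℝ} {M : ℝ}
    (hle : ∀ x ∈ Icc (0 : ℝ) 1, μ x ≤ M) (k : ℕ) :
    ∫⁻ u : Fin k → ℝ, ∫⁻ t, unif (block u t) ^ 2 ∂designLaw μ ∂Measure.pi (fun _ => unif)
      ≤ ENNReal.ofReal M * (6 / ((k + 3) * (k + 2))) := by
  calc _ ≤ ∫⁻ u : Fin k → ℝ, ENNReal.ofReal M * ∫⁻ t, unif (block u t) ^ 2 ∂unif
          ∂Measure.pi (fun _ => unif) := by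
        refine lintegral_mono fun u => ?_
        rw [← smul_eq_mul, ← lintegral_smul_measure]
        exact lintegral_mono' (designLaw_le hle) le_rfl
    _ = ENNReal.ofReal M * ∫⁻ u : Fin k → ℝ, ∫⁻ t, unif (block u t) ^ 2 ∂unif
          ∂Measure.pi (fun _ => unif) := lintegral_const_mul' _ _ ENNReal.ofReal_ne_top
    _ ≤ _ := by gcongr; exact lintegral_sq_measure_block_le k

/-- Either the cell is shorter than τ, which is rare, or its design mass is at least mτ and the
Chernoff bound decays exponentially. -/
lemma lintegral_measure_hits_lt_le {μ : ℝ → ℝ} {m M : ℝ} (hm : 0 ≤ m)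
    (hmμ : ∀ x ∈ Icc (0 : ℝ) 1, m ≤ μ x) (hle : ∀ x ∈ Icc (0 : ℝ) 1, μ x ≤ M)
    [IsProbabilityMeasure (designLaw μ)] {k n : ℕ} (hk : 1 ≤ k) (K : ℕ) {τ : ℝ}
    (hτ : τ ≤ 1 / 2) :
    ∫⁻ u : Fin k → ℝ, ∫⁻ t, Measure.pi (fun _ : Fin n => designLaw μ)
        {x | hits (block u t) x < K} ∂designLaw μ ∂Measure.pi (fun _ => unif)
      ≤ 2 ^ K * (ENNReal.ofReal M * (3 * (k * ENNReal.ofReal τ) ^ 2)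
          + ENNReal.ofReal (Real.exp (-(n * (m * τ) / 2)))) := by
  set T := ENNReal.ofReal τ
  set e := ENNReal.ofReal (Real.exp (-(n * (m * τ) / 2)))
  let S : Set ((Fin k → ℝ) × ℝ) := {p | unif (block p.1 p.2) < T}
  have hS : MeasurableSet S := measurable_measure_block unif measurableSet_Iio
  have hSi : Measurable (S.indicator (1 : (Fin k → ℝ) × ℝ → ℝ≥0∞)) := measurable_one.indicator hS
  have hpt : ∀ (u : Fin k → ℝ) (t : ℝ), Measure.pi (fun _ : Fin n => designLaw μ)
      {x | hits (block u t) x < K} ≤ 2 ^ K * (S.indicator 1 (u, t) + e) := by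
    intro u t
    refine (measure_hits_lt_le (designLaw μ) (measurableSet_block u t) K).trans ?_
    gcongr
    by_cases h : (u, t) ∈ S
    · refine le_trans ?_ le_self_add
      rw [indicator_of_mem h, Pi.one_apply, ENNReal.ofReal_le_one, Real.exp_le_one_iff]
      have : 0 ≤ (designLaw μ).real (block u t) := measureReal_nonneg
      have : 0 ≤ n * (designLaw μ).real (block u t) / 2 := by positivity
      linarith
    · refine le_trans ?_ le_add_self
      refine ENNReal.ofReal_le_ofReal (Real.exp_le_exp.2 ?_)
      have h1 : ENNReal.ofReal (m * τ) ≤ designLaw μ (block u t) := by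
        rw [ENNReal.ofReal_mul hm]
        refine le_trans ?_ (le_designLaw_apply (measurableSet_block u t) fun y hy => hmμ y hy.2)
        gcongr
        exact not_lt.1 h
      have h2 : m * τ ≤ (designLaw μ).real (block u t) :=
        (ENNReal.ofReal_le_iff_le_toReal (measure_ne_top _ _)).1 h1
      have : (n : ℝ) * (m * τ) ≤ n * (designLaw μ).real (block u t) := by gcongr
      linarith
  have hSle : ∫⁻ u : Fin k → ℝ, ∫⁻ t, S.indicator 1 (u, t) ∂designLaw μ
      ∂Measure.pi (fun _ => unif) ≤ ENNReal.ofReal M * (3 * (k * T) ^ 2) := by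
    calc _ ≤ ∫⁻ u : Fin k → ℝ, ENNReal.ofReal M * ∫⁻ t, S.indicator 1 (u, t) ∂unif
            ∂Measure.pi (fun _ => unif) := by
          refine lintegral_mono fun u => ?_
          rw [← smul_eq_mul, ← lintegral_smul_measure]
          exact lintegral_mono' (designLaw_le hle) le_rfl
      _ = ENNReal.ofReal M * ∫⁻ u : Fin k → ℝ, ∫⁻ t, S.indicator 1 (u, t) ∂unif
            ∂Measure.pi (fun _ => unif) := lintegral_const_mul' _ _ ENNReal.ofReal_ne_top
      _ = ENNReal.ofReal M * ∫⁻ t, ∫⁻ u : Fin k → ℝ, S.indicator 1 (u, t)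
            ∂Measure.pi (fun _ => unif) ∂unif := by
          rw [lintegral_lintegral_swap]
          exact hSi.aemeasurable
      _ = ENNReal.ofReal M * ∫⁻ t, Measure.pi (fun _ : Fin k => unif)
            {u | unif (block u t) < T} ∂unif := by
          congr 1
          refine lintegral_congr fun t => ?_
          have hSt : MeasurableSet {u : Fin k → ℝ | unif (block u t) < T} :=
            hS.preimage measurable_prodMk_right
          rw [← lintegral_indicator_one hSt]
          rfl
      _ ≤ _ := by
          gcongr
          exact lintegral_measure_block_lt_le hk hτ
  calc _ ≤ ∫⁻ u : Fin k → ℝ, ∫⁻ t, 2 ^ K * (S.indicator 1 (u, t) + e) ∂designLaw μ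
          ∂Measure.pi (fun _ => unif) :=
        lintegral_mono fun u => lintegral_mono fun t => hpt u t
    _ = 2 ^ K * (∫⁻ u : Fin k → ℝ, ∫⁻ t, S.indicator 1 (u, t) ∂designLaw μ
          ∂Measure.pi (fun _ => unif) + e) := by
        have h2 : (2 ^ K : ℝ≥0∞) ≠ ∞ := by simp
        simp_rw [lintegral_const_mul' _ _ h2, lintegral_add_right _ measurable_const,
          lintegral_const, measure_univ, mul_one]
    _ ≤ _ := by gcongr

end Averages

/-! ### Weights of a tree and of a pair of trees -/

section Weights

variable {k n : ℕ}

lemma weight_nonneg (u : Fin k → ℝ) (x : Fin n → ℝ) (t : ℝ) (i : Fin n) : 0 ≤ weight u x t i :=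
  indicator_nonneg (fun _ _ => by positivity) _

lemma cast_hits (A : Set ℝ) (x : Fin n → ℝ) :
    (hits A x : ℝ) = ∑ i, A.indicator (fun _ => (1 : ℝ)) (x i) := by
  rw [hits, Nat.cast_sum]
  refine Finset.sum_congr rfl fun i _ => ?_
  by_cases h : x i ∈ A <;> simp [h]

/-- The right-hand side is 1, or 0 for an empty block because the inverse of 0 is 0. -/
lemma sum_weight (u : Fin k → ℝ) (x : Fin n → ℝ) (t : ℝ) :
    ∑ i, weight u x t i = (hits (block u t) x : ℝ) * (hits (block u t) x : ℝ)⁻¹ := by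
  conv_rhs => rw [cast_hits, ← cast_hits, cast_hits (x := x), Finset.sum_mul]
  refine Finset.sum_congr rfl fun i _ => ?_
  by_cases h : x i ∈ block u t <;> simp [weight, h, cast_hits]

lemma sum_weight_le_one (u : Fin k → ℝ) (x : Fin n → ℝ) (t : ℝ) : ∑ i, weight u x t i ≤ 1 := by
  rw [sum_weight]; exact mul_inv_le_one

lemma weight_le_one (u : Fin k → ℝ) (x : Fin n → ℝ) (t : ℝ) (i : Fin n) : weight u x t i ≤ 1 :=
  (Finset.single_le_sum (fun j _ => weight_nonneg u x t j) (Finset.mem_univ i)).trans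
    (sum_weight_le_one u x t)

lemma sum_weight_mul_weight (u v : Fin k → ℝ) (x : Fin n → ℝ) (t : ℝ) :
    ∑ i, weight u x t i * weight v x t i = (hits (block u t ∩ block v t) x : ℝ) *
      ((hits (block u t) x : ℝ)⁻¹ * (hits (block v t) x : ℝ)⁻¹) := by
  rw [cast_hits (block u t ∩ block v t), Finset.sum_mul]
  refine Finset.sum_congr rfl fun i _ => ?_
  by_cases h : x i ∈ block u t <;> by_cases h' : x i ∈ block v t <;> simp [weight, h, h']

lemma sum_weight_sq_le (u : Fin k → ℝ) (x : Fin n → ℝ) (t : ℝ) :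
    ∑ i, weight u x t i * weight u x t i ≤ 2 * ((hits (block u t) x : ℝ) + 1)⁻¹ := by
  rw [sum_weight_mul_weight, inter_self]
  rcases Nat.eq_zero_or_pos (hits (block u t) x) with h | h
  · simp [h]
  · have h1 : (1 : ℝ) ≤ hits (block u t) x := by exact_mod_cast h
    set N : ℝ := (hits (block u t) x : ℝ)
    rw [← mul_assoc, mul_inv_cancel₀ (by positivity), one_mul, ← div_eq_mul_inv,
      inv_eq_one_div, div_le_div_iff₀ (by positivity) (by positivity)]
    linarith

lemma hits_union_add_inter (A B : Set ℝ) (x : Fin n → ℝ) :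
    hits (A ∪ B) x + hits (A ∩ B) x = hits A x + hits B x := by
  simp only [hits, ← Finset.sum_add_distrib]
  refine Finset.sum_congr rfl fun i _ => ?_
  by_cases h : x i ∈ A <;> by_cases h' : x i ∈ B <;> simp [h, h']

/-- If the first cell has at least K points, the sum is at most 1/W with W ≥ K the count in the
union, and 1/W ≤ (1 + 1/K)/(W + 1). Otherwise the sum is at most 1, which the indicator absorbs. -/
lemma sum_weight_mul_weight_le (u v : Fin k → ℝ) (x : Fin n → ℝ) (t : ℝ) {K : ℕ} (hK : 1 ≤ K) :
    ∑ i, weight u x t i * weight v x t i ≤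
      (1 + 1 / (K : ℝ)) * ((hits (block u t ∪ block v t) x : ℝ) + 1)⁻¹
        + {N : ℕ | N < K}.indicator 1 (hits (block u t) x) := by
  have hK' : (1 : ℝ) ≤ K := by exact_mod_cast hK
  by_cases h : hits (block u t) x < K
  · rw [indicator_of_mem (show hits (block u t) x ∈ {N : ℕ | N < K} from h), Pi.one_apply]
    have h1 : ∑ i, weight u x t i * weight v x t i ≤ 1 :=
      (Finset.sum_le_sum fun i _ => mul_le_of_le_one_right (weight_nonneg u x t i)
        (weight_le_one v x t i)).trans (sum_weight_le_one u x t)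
    have h2 : 0 ≤ (1 + 1 / (K : ℝ)) * ((hits (block u t ∪ block v t) x : ℝ) + 1)⁻¹ := by
      positivity
    linarith
  · rw [indicator_of_notMem (show hits (block u t) x ∉ {N : ℕ | N < K} from h), add_zero,
      sum_weight_mul_weight]
    have e1 : (hits (block u t ∪ block v t) x : ℝ) + hits (block u t ∩ block v t) x
        = hits (block u t) x + hits (block v t) x := by
      exact_mod_cast hits_union_add_inter _ _ x
    have e2 : (hits (block u t ∩ block v t) x : ℝ) ≤ hits (block v t) x := by
      exact_mod_cast hits_mono inter_subset_right x
    have e3 : (hits (block u t) x : ℝ) ≤ hits (block u t ∪ block v t) x := by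
      exact_mod_cast hits_mono subset_union_left x
    have e4 : (K : ℝ) ≤ hits (block u t) x := by exact_mod_cast not_lt.1 h
    have e5 : (0 : ℝ) ≤ hits (block u t ∩ block v t) x := by positivity
    have e6 : (hits (block u t ∩ block v t) x : ℝ) ≤ hits (block u t) x := by
      exact_mod_cast hits_mono inter_subset_left x
    generalize (hits (block u t ∪ block v t) x : ℝ) = W at *
    generalize (hits (block u t ∩ block v t) x : ℝ) = I at *
    generalize (hits (block u t) x : ℝ) = A at *
    generalize (hits (block v t) x : ℝ) = B at *
    -- No lower bound on `B` is assumed; either the intersection is empty and the left side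
    -- vanishes, or `B ≥ I > 0`.
    rcases e5.eq_or_lt with h0 | h0
    · rw [← h0, zero_mul]
      have : 0 ≤ W := by linarith
      positivity
    have hA : 0 < A := by linarith
    have hB : 0 < B := by linarith
    have hW : 0 < W := by linarith
    have hle : I * (A⁻¹ * B⁻¹) ≤ W⁻¹ := by
      rw [← mul_inv, ← div_eq_mul_inv, inv_eq_one_div,
        div_le_div_iff₀ (by positivity) hW]
      have hWe : W = A + B - I := by linarith
      rw [hWe]
      -- AB - I(A + B - I) = (A - I)(B - I).
      nlinarith [mul_nonneg (sub_nonneg.2 e6) (sub_nonneg.2 e2)]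
    refine hle.trans ?_
    rw [← div_eq_mul_inv, inv_eq_one_div, div_le_div_iff₀ hW (by positivity)]
    have : 1 ≤ 1 / (K : ℝ) * W := by
      rw [one_div, inv_mul_eq_div, one_le_div (by positivity)]; linarith
    nlinarith

/-- In a nonempty cell the weights sum to 1 and every point used lies within the cell length of `t`.
In an empty cell the tree is 0 and the squared error is at most S²; `1 ≤ K` makes the indicator
cover this case. -/
lemma bias_sq_le {s : ℝ → ℝ} {C : ℝ≥0} {S : ℝ} (hs : LipschitzOnWith C s (Icc 0 1))
    (hS : ∀ x ∈ Icc (0 : ℝ) 1, |s x| ≤ S) (u : Fin k → ℝ) {x : Fin n → ℝ} {t : ℝ}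
    (ht : t ∈ Icc (0 : ℝ) 1) (hx : ∀ i, x i ∈ Icc (0 : ℝ) 1) {K : ℕ} (hK : 1 ≤ K) :
    (∑ i, weight u x t i * s (x i) - s t) ^ 2 ≤
      (C : ℝ) ^ 2 * unif.real (block u t) ^ 2
        + S ^ 2 * {N : ℕ | N < K}.indicator 1 (hits (block u t) x) := by
  rcases Nat.eq_zero_or_pos (hits (block u t) x) with h | h
  · have hw : ∀ i, weight u x t i = 0 := fun i => by
      simp [weight, h]
    simp only [hw, h]
    rw [indicator_of_mem (show 0 ∈ {N : ℕ | N < K} from hK)]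
    have h1 : s t ^ 2 ≤ S ^ 2 := sq_le_sq.2 ((hS t ht).trans (le_abs_self S))
    have h2 : 0 ≤ (C : ℝ) ^ 2 * unif.real (block u t) ^ 2 := by positivity
    simp only [zero_mul, Finset.sum_const_zero, Pi.one_apply, mul_one]
    linarith
  · have hsum : ∑ i, weight u x t i = 1 := by
      rw [sum_weight]; exact mul_inv_cancel₀ (by positivity)
    have hdiff : ∀ i, |weight u x t i * (s (x i) - s t)|
        ≤ weight u x t i * (C * unif.real (block u t)) := fun i => by
      rw [abs_mul, abs_of_nonneg (weight_nonneg u x t i)]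
      by_cases hi : x i ∈ block u t
      · refine mul_le_mul_of_nonneg_left ?_ (weight_nonneg u x t i)
        have h1 := hs.dist_le_mul (x i) (hx i) t ht
        rw [Real.dist_eq, Real.dist_eq] at h1
        refine h1.trans ?_
        gcongr
        exact (ENNReal.ofReal_le_iff_le_toReal (measure_ne_top _ _)).1
          (ofReal_abs_sub_le_block ht (hx i) hi)
      · simp [weight, hi]
    have hb : |∑ i, weight u x t i * s (x i) - s t| ≤ C * unif.real (block u t) := by
      have : ∑ i, weight u x t i * s (x i) - s t = ∑ i, weight u x t i * (s (x i) - s t) := by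
        simp only [mul_sub, Finset.sum_sub_distrib, ← Finset.sum_mul, hsum, one_mul]
      rw [this]
      refine (Finset.abs_sum_le_sum_abs _ _).trans ((Finset.sum_le_sum fun i _ => hdiff i).trans ?_)
      rw [← Finset.sum_mul, hsum, one_mul]
    calc _ ≤ ((C : ℝ) * unif.real (block u t)) ^ 2 := sq_le_sq' (abs_le.1 hb).1 (abs_le.1 hb).2
      _ = (C : ℝ) ^ 2 * unif.real (block u t) ^ 2 := mul_pow _ _ _
      _ ≤ _ := le_add_of_nonneg_right
          (mul_nonneg (sq_nonneg S) (indicator_nonneg (fun _ _ => zero_le_one) _))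

end Weights

/-! ### Weights of the forest -/

section ForestWeights

variable {k n q : ℕ}

/-- The weight of the `i`-th response in the forest at `t`. -/
def forestWeight (v : Fin q → Fin k → ℝ) (x : Fin n → ℝ) (t : ℝ) (i : Fin n) : ℝ :=
  (1 / (q : ℝ)) * ∑ l, weight (v l) x t i

lemma forest_eq_sum_forestWeight (v : Fin q → Fin k → ℝ) {x : Fin n → ℝ} (y : Fin n → ℝ) {t : ℝ}
    (ht : t ∈ Ioc (0 : ℝ) 1) (hx : ∀ i, x i ∈ Ioc (0 : ℝ) 1) :
    forest v x y t = ∑ i, forestWeight v x t i * y i := by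
  simp only [forest, forestWeight, tree_eq_sum_weight _ y ht hx, mul_assoc, ← Finset.mul_sum,
    Finset.sum_mul]
  rw [Finset.sum_comm]

lemma forestWeight_nonneg (v : Fin q → Fin k → ℝ) (x : Fin n → ℝ) (t : ℝ) (i : Fin n) :
    0 ≤ forestWeight v x t i :=
  mul_nonneg (by positivity) (Finset.sum_nonneg fun l _ => weight_nonneg (v l) x t i)

lemma sum_forestWeight_le_one (v : Fin q → Fin k → ℝ) (x : Fin n → ℝ) (t : ℝ) :
    ∑ i, forestWeight v x t i ≤ 1 := by
  simp only [forestWeight, ← Finset.mul_sum]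
  rw [Finset.sum_comm]
  calc _ ≤ 1 / (q : ℝ) * ∑ _l : Fin q, (1 : ℝ) := by
        gcongr with l _
        exact sum_weight_le_one (v l) x t
    _ ≤ 1 := by simpa using inv_mul_le_one

lemma sum_forestWeight_sq_le_one (v : Fin q → Fin k → ℝ) (x : Fin n → ℝ) (t : ℝ) :
    ∑ i, forestWeight v x t i ^ 2 ≤ 1 := by
  have h1 : ∀ i, forestWeight v x t i ≤ 1 := fun i =>
    (Finset.single_le_sum (fun j _ => forestWeight_nonneg v x t j) (Finset.mem_univ i)).trans
      (sum_forestWeight_le_one v x t)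
  refine (Finset.sum_le_sum fun i _ => ?_).trans (sum_forestWeight_le_one v x t)
  rw [sq]
  exact mul_le_of_le_one_right (forestWeight_nonneg v x t i) (h1 i)

lemma forest_bias_sq_le_crude {s : ℝ → ℝ} {S : ℝ} (hS : ∀ x ∈ Icc (0 : ℝ) 1, |s x| ≤ S)
    (v : Fin q → Fin k → ℝ) {x : Fin n → ℝ} {t : ℝ}
    (ht : t ∈ Icc (0 : ℝ) 1) (hx : ∀ i, x i ∈ Icc (0 : ℝ) 1) :
    (∑ i, forestWeight v x t i * s (x i) - s t) ^ 2 ≤ (2 * S) ^ 2 := by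
  have hS0 : 0 ≤ S := (abs_nonneg _).trans (hS t ht)
  have h1 : |∑ i, forestWeight v x t i * s (x i)| ≤ S := by
    calc _ ≤ ∑ i, forestWeight v x t i * S := by
          refine (Finset.abs_sum_le_sum_abs _ _).trans (Finset.sum_le_sum fun i _ => ?_)
          rw [abs_mul, abs_of_nonneg (forestWeight_nonneg v x t i)]
          exact mul_le_mul_of_nonneg_left (hS _ (hx i)) (forestWeight_nonneg v x t i)
      _ ≤ S := by
          rw [← Finset.sum_mul]
          exact mul_le_of_le_one_left hS0 (sum_forestWeight_le_one v x t)
  refine sq_le_sq.2 ?_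
  rw [abs_of_nonneg (by positivity : 0 ≤ 2 * S)]
  have h2 := abs_sub (∑ i, forestWeight v x t i * s (x i)) (s t)
  have h3 := hS t ht
  linarith

/-- Cauchy–Schwarz: the forest bias is the mean of the tree biases. -/
lemma forest_bias_sq_le (s : ℝ → ℝ) (hq : 1 ≤ q) (v : Fin q → Fin k → ℝ) (x : Fin n → ℝ)
    (t : ℝ) :
    (∑ i, forestWeight v x t i * s (x i) - s t) ^ 2 ≤
      1 / (q : ℝ) * ∑ l, (∑ i, weight (v l) x t i * s (x i) - s t) ^ 2 := by
  have hq' : (0 : ℝ) < q := by exact_mod_cast hq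
  have h : ∑ i, forestWeight v x t i * s (x i) - s t
      = 1 / (q : ℝ) * ∑ l, (∑ i, weight (v l) x t i * s (x i) - s t) := by
    simp only [forestWeight, mul_assoc, ← Finset.mul_sum, Finset.sum_mul, Finset.sum_sub_distrib]
    rw [Finset.sum_comm]
    simp only [Finset.sum_const, Finset.card_univ, Fintype.card_fin, nsmul_eq_mul]
    field_simp
  have hcs := sq_sum_le_card_mul_sum_sq (s := (Finset.univ : Finset (Fin q)))
    (f := fun l => ∑ i, weight (v l) x t i * s (x i) - s t)
  rw [Finset.card_univ, Fintype.card_fin] at hcs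
  rw [h, mul_pow]
  calc _ ≤ (1 / (q : ℝ)) ^ 2 * (q * ∑ l, (∑ i, weight (v l) x t i * s (x i) - s t) ^ 2) := by
        gcongr
    _ = _ := by field_simp

lemma sum_forestWeight_sq_eq (v : Fin q → Fin k → ℝ) (x : Fin n → ℝ) (t : ℝ) :
    ∑ i, forestWeight v x t i ^ 2 =
      (1 / (q : ℝ)) ^ 2 * ∑ p : Fin q × Fin q, ∑ i, weight (v p.1) x t i * weight (v p.2) x t i := by
  simp only [forestWeight, mul_pow, ← Finset.mul_sum, sq (∑ l, weight (v l) x t _)]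
  congr 1
  rw [Finset.sum_comm]
  refine Finset.sum_congr rfl fun i _ => ?_
  rw [Finset.sum_mul_sum, Fintype.sum_prod_type]

end ForestWeights

/-! ### Integrating out the noise -/

section Noise

lemma lintegral_sq_noise {n : ℕ} {ν : Measure ℝ} [IsProbabilityMeasure ν] {σ : ℝ}
    (hL2 : MemLp id 2 ν) (hmean : ∫ e, e ∂ν = 0) (hvar : Var[id; ν] = σ ^ 2) (a : Fin n → ℝ)
    (b : ℝ) :
    ∫⁻ e : Fin n → ℝ, ENNReal.ofReal ((∑ i, a i * e i + b) ^ 2) ∂Measure.pi (fun _ => ν)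
      = ENNReal.ofReal (σ ^ 2 * ∑ i, a i ^ 2 + b ^ 2) := by
  set π := Measure.pi (fun _ : Fin n => ν)
  have hi : ∀ i, MemLp (fun e : Fin n → ℝ => a i * e i) 2 π := fun i =>
    (hL2.comp_measurePreserving (measurePreserving_eval (fun _ : Fin n => ν) i)).const_mul (a i)
  have hZ : MemLp (fun e : Fin n → ℝ => ∑ i, a i * e i) 2 π :=
    memLp_finsetSum _ fun i _ => hi i
  have hZb : MemLp (fun e : Fin n → ℝ => ∑ i, a i * e i + b) 2 π := hZ.add (memLp_const b)
  have hmeanZ : ∫ e, (∑ i, a i * e i) ∂π = 0 := by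
    rw [integral_finsetSum _ fun i _ => (hi i).integrable one_le_two]
    refine Finset.sum_eq_zero fun i _ => ?_
    have h0 : ∫ e : Fin n → ℝ, e i ∂π = 0 := (integral_comp_eval (μ := fun _ : Fin n => ν) (i := i)
      (f := id) hL2.aestronglyMeasurable).trans hmean
    rw [integral_const_mul, h0, mul_zero]
  have hvarZ : Var[fun e : Fin n → ℝ => ∑ i, a i * e i; π] = σ ^ 2 * ∑ i, a i ^ 2 := by
    have h := variance_sum_pi (μ := fun _ : Fin n => ν) (X := fun i e => a i * e)
      (fun i => hL2.const_mul (a i))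
    have h2 : (∑ i, fun ω : Fin n → ℝ => a i * ω i) = fun e => ∑ i, a i * e i := by
      ext e; simp
    rw [h2] at h
    rw [h, Finset.mul_sum]
    refine Finset.sum_congr rfl fun i _ => ?_
    rw [variance_const_mul, mul_comm]
    congr 1
  rw [← ofReal_integral_eq_lintegral_ofReal hZb.integrable_sq (ae_of_all _ fun _ => sq_nonneg _)]
  congr 1
  have h := variance_eq_sub hZb
  rw [variance_add_const hZ.aestronglyMeasurable b, hvarZ,
    integral_add (hZ.integrable one_le_two) (integrable_const b), hmeanZ] at h
  simp only [integral_const, probReal_univ, one_smul, zero_add, Pi.pow_apply] at h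
  linarith

end Noise

/-! ### Product form of the model -/

section Model

variable {μ : ℝ → ℝ} {ν : Measure ℝ} {n k q : ℕ} {Ω : Type*} [MeasurableSpace Ω] {P : Measure Ω}
  {X ε : Fin n → Ω → ℝ} {U : Fin q → Fin k → Ω → ℝ} {X₀ : Ω → ℝ}

/-- The laws of the variables of the model. -/
def modelLaw (μ : ℝ → ℝ) (ν : Measure ℝ) (n k q : ℕ) :
    (Fin n ⊕ Fin n) ⊕ ((Fin q × Fin k) ⊕ Unit) → Measure ℝ :=
  Sum.elim (Sum.elim (fun _ => designLaw μ) fun _ => ν)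
    (Sum.elim (fun _ => unif) fun _ => designLaw μ)

lemma IsModel.hasLaw (h : IsModel μ ν P X ε U X₀) (i) :
    HasLaw (Sum.elim (Sum.elim X ε) (Sum.elim (fun p : Fin q × Fin k => U p.1 p.2)
      (fun _ : Unit => X₀)) i) (modelLaw μ ν n k q i) P := by
  rcases i with ((i | i) | (p | _))
  · exact h.law_design i
  · exact h.law_noise i
  · exact h.law_split p.1 p.2
  · exact h.law_test

lemma IsModel.lintegral_eq [IsProbabilityMeasure P] [IsProbabilityMeasure (designLaw μ)]
    (h : IsModel μ ν P X ε U X₀) {J : Type*} [Fintype J] {e : J → Fin q × Fin k}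
    (he : Function.Injective e) {F : (J → ℝ) × ℝ × (Fin n → ℝ) → ℝ≥0∞} (hF : Measurable F) :
    ∫⁻ ω, F (fun j => U (e j).1 (e j).2 ω, X₀ ω, fun i => X i ω) ∂P
      = ∫⁻ u, ∫⁻ t, ∫⁻ x, F (u, t, x) ∂Measure.pi (fun _ => designLaw μ) ∂designLaw μ
          ∂Measure.pi (fun _ => unif) := by
  let g : J ⊕ (Unit ⊕ Fin n) → (Fin n ⊕ Fin n) ⊕ ((Fin q × Fin k) ⊕ Unit) :=
    Sum.elim (fun j => .inr (.inl (e j))) (Sum.elim (fun _ => .inr (.inr ())) fun i => .inl (.inl i))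
  have hg : Function.Injective g := by
    rintro (j | (_ | i)) (j' | (_ | i')) hij <;> simp [g] at hij ⊢
    · exact he hij
    · exact hij
  let G : (J ⊕ (Unit ⊕ Fin n) → ℝ) → ℝ≥0∞ := fun z =>
    F (fun j => z (.inl j), z (.inr (.inl ())), fun i => z (.inr (.inr i)))
  have hG : Measurable G := hF.comp (by fun_prop)
  have : ∀ i, IsProbabilityMeasure (modelLaw μ ν n k q (g i)) := by
    rintro (j | (_ | i)) <;> simp only [g, modelLaw, Sum.elim_inl, Sum.elim_inr] <;> infer_instance
  have h1 := lintegral_comp_eq_lintegral_pi h.indep h.hasLaw hg hG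
  refine Eq.trans ?_ (h1.trans ?_)
  · rfl
  · rw [lintegral_pi_sum _ hG]
    refine lintegral_congr fun u => ?_
    rw [lintegral_pi_sum (fun j => modelLaw μ ν n k q (g (.inr j)))
      (F := fun b => G (Sum.elim u b)) (hG.comp (measurable_sumElim.comp measurable_prodMk_left)),
      lintegral_pi_unit]
    · rfl
    · exact ((hG.comp (measurable_sumElim.comp measurable_prodMk_left)).comp
        measurable_sumElim).lintegral_prod_right'

/-- The noise coordinates are placed last, so that the inner integral is over the noise alone, with
the coefficients `a` and `b` frozen. -/
lemma IsModel.lintegral_noise_eq [IsProbabilityMeasure P] [IsProbabilityMeasure ν]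
    [IsProbabilityMeasure (designLaw μ)] (h : IsModel μ ν P X ε U X₀) {σ : ℝ}
    (hL2 : MemLp id 2 ν) (hmean : ∫ e, e ∂ν = 0) (hvar : Var[id; ν] = σ ^ 2)
    {a : Fin n → (Fin q × Fin k → ℝ) × ℝ × (Fin n → ℝ) → ℝ} (ha : ∀ i, Measurable (a i))
    {b : (Fin q × Fin k → ℝ) × ℝ × (Fin n → ℝ) → ℝ} (hb : Measurable b) :
    ∫⁻ ω, ENNReal.ofReal ((∑ i, a i (fun p => U p.1 p.2 ω, X₀ ω, fun i => X i ω) * ε i ω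
        + b (fun p => U p.1 p.2 ω, X₀ ω, fun i => X i ω)) ^ 2) ∂P
      = ∫⁻ ω, ENNReal.ofReal (σ ^ 2 * ∑ i, a i (fun p => U p.1 p.2 ω, X₀ ω, fun i => X i ω) ^ 2
        + b (fun p => U p.1 p.2 ω, X₀ ω, fun i => X i ω) ^ 2) ∂P := by
  let R := (Fin q × Fin k) ⊕ (Unit ⊕ Fin n)
  let gR : R → (Fin n ⊕ Fin n) ⊕ ((Fin q × Fin k) ⊕ Unit) :=
    Sum.elim (fun j => .inr (.inl j)) (Sum.elim (fun _ => .inr (.inr ())) fun i => .inl (.inl i))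
  let g : R ⊕ Fin n → (Fin n ⊕ Fin n) ⊕ ((Fin q × Fin k) ⊕ Unit) :=
    Sum.elim gR fun i => .inl (.inr i)
  have hgR : Function.Injective gR := by
    rintro (j | (_ | i)) (j' | (_ | i')) hij <;> simp [gR] at hij ⊢ <;> rw [hij]
  have hg : Function.Injective g := by
    rintro ((j | (_ | i)) | i) ((j' | (_ | i')) | i') hij <;> simp [g, gR] at hij ⊢ <;> rw [hij]
  let T : (R → ℝ) → (Fin q × Fin k → ℝ) × ℝ × (Fin n → ℝ) := fun z =>
    (fun j => z (.inl j), z (.inr (.inl ())), fun i => z (.inr (.inr i)))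
  have hT : Measurable T := by fun_prop
  let G : (R ⊕ Fin n → ℝ) → ℝ≥0∞ := fun z => ENNReal.ofReal
    ((∑ i, a i (T fun r => z (.inl r)) * z (.inr i) + b (T fun r => z (.inl r))) ^ 2)
  have hG : Measurable G := by
    have hT' : Measurable fun z : R ⊕ Fin n → ℝ => T fun r => z (.inl r) :=
      hT.comp (g := T) (f := fun (z : R ⊕ Fin n → ℝ) (r : R) => z (.inl r))
        (measurable_pi_lambda _ fun _ => measurable_pi_apply _)
    refine (((Finset.measurable_fun_sum _ fun i _ => ((ha i).comp hT').mul
      (measurable_pi_apply _)).add (hb.comp hT')).pow_const 2).ennreal_ofReal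
  let H : (R → ℝ) → ℝ≥0∞ := fun z => ENNReal.ofReal (σ ^ 2 * ∑ i, a i (T z) ^ 2 + b (T z) ^ 2)
  have hH : Measurable H :=
    (((Finset.measurable_fun_sum _ fun i _ => ((ha i).comp hT).pow_const 2).const_mul _).add
      ((hb.comp hT).pow_const 2)).ennreal_ofReal
  have : ∀ i, IsProbabilityMeasure (modelLaw μ ν n k q (g i)) := by
    rintro ((j | (_ | i)) | i) <;> simp only [g, gR, modelLaw, Sum.elim_inl, Sum.elim_inr] <;>
      infer_instance
  have h1 := lintegral_comp_eq_lintegral_pi h.indep h.hasLaw hg hG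
  have h2 := lintegral_comp_eq_lintegral_pi h.indep h.hasLaw hgR hH
  refine Eq.trans (Eq.trans ?_ (h1.trans ?_)) (h2.symm.trans ?_)
  · rfl
  · rw [lintegral_pi_sum _ hG]
    exact lintegral_congr fun z => lintegral_sq_noise hL2 hmean hvar (fun i => a i (T z)) (b (T z))
  · rfl

end Model

/-! ### Calculus of integrable variables with bounded mean -/

section MeanLE

variable {Ω : Type*} [MeasurableSpace Ω] {P : Measure Ω}

/-- The random variable `φ` is integrable, and its mean is at most `b`. -/
def MeanLE (P : Measure Ω) (φ : Ω → ℝ) (b : ℝ) : Prop := Integrable φ P ∧ ∫ ω, φ ω ∂P ≤ b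

lemma MeanLE.add {φ ψ : Ω → ℝ} {b c : ℝ} (h : MeanLE P φ b) (h' : MeanLE P ψ c) :
    MeanLE P (fun ω => φ ω + ψ ω) (b + c) :=
  ⟨h.1.add h'.1, by rw [integral_add h.1 h'.1]; exact add_le_add h.2 h'.2⟩

lemma MeanLE.const_mul {φ : Ω → ℝ} {b c : ℝ} (hc : 0 ≤ c) (h : MeanLE P φ b) :
    MeanLE P (fun ω => c * φ ω) (c * b) :=
  ⟨h.1.const_mul c, by rw [integral_const_mul]; exact mul_le_mul_of_nonneg_left h.2 hc⟩

lemma MeanLE.sum {ι : Type*} {s : Finset ι} {φ : ι → Ω → ℝ} {b : ι → ℝ}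
    (h : ∀ i ∈ s, MeanLE P (φ i) (b i)) : MeanLE P (fun ω => ∑ i ∈ s, φ i ω) (∑ i ∈ s, b i) :=
  ⟨integrable_finsetSum _ fun i hi => (h i hi).1, by
    rw [integral_finsetSum _ fun i hi => (h i hi).1]
    exact Finset.sum_le_sum fun i hi => (h i hi).2⟩

lemma MeanLE.trans {φ : Ω → ℝ} {b c : ℝ} (h : MeanLE P φ b) (hbc : b ≤ c) : MeanLE P φ c :=
  ⟨h.1, h.2.trans hbc⟩

lemma MeanLE.of_lintegral_le {φ : Ω → ℝ} {b : ℝ} (hφ : AEMeasurable φ P) (h0 : ∀ ω, 0 ≤ φ ω)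
    (hb : 0 ≤ b) (h : ∫⁻ ω, ENNReal.ofReal (φ ω) ∂P ≤ ENNReal.ofReal b) : MeanLE P φ b := by
  refine ⟨⟨hφ.aestronglyMeasurable, ?_⟩, ?_⟩
  · rw [hasFiniteIntegral_iff_ofReal (ae_of_all _ h0)]
    exact h.trans_lt ENNReal.ofReal_lt_top
  · rw [integral_eq_lintegral_of_nonneg_ae (ae_of_all _ h0) hφ.aestronglyMeasurable]
    exact ENNReal.toReal_le_of_le_ofReal hb h

lemma MeanLE.lintegral_le {φ : Ω → ℝ} {b : ℝ} (h : MeanLE P φ b) (h0 : ∀ᵐ ω ∂P, 0 ≤ φ ω) :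
    ∫⁻ ω, ENNReal.ofReal (φ ω) ∂P ≤ ENNReal.ofReal b := by
  rw [← ofReal_integral_eq_lintegral_ofReal h.1 h0]
  exact ENNReal.ofReal_le_ofReal h.2

end MeanLE

/-! ### Joint measurability of counts and weights -/

section Measurability

variable {k n q : ℕ}

lemma measurable_hits_block : Measurable fun p : (Fin k → ℝ) × ℝ × (Fin n → ℝ) =>
    hits (block p.1 p.2.1) p.2.2 := by
  classical
  simp only [hits, indicator_apply]
  refine Finset.measurable_fun_sum _ fun i _ => Measurable.ite ?_ measurable_const measurable_const
  exact measurableSet_eq_fun (Measurable.cnt (by fun_prop) (by fun_prop))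
    (Measurable.cnt (by fun_prop) (by fun_prop))

lemma measurable_hits_wide : Measurable fun p : (Fin (k + k) → ℝ) × ℝ × (Fin n → ℝ) =>
    hits (wide p.1 p.2.1) p.2.2 := by
  classical
  simp only [hits, indicator_apply]
  refine Finset.measurable_fun_sum _ fun i _ => Measurable.ite ?_ measurable_const measurable_const
  exact measurableSet_mem_wide.preimage (f := fun p : (Fin (k + k) → ℝ) × ℝ × (Fin n → ℝ) =>
    ((p.1, p.2.1), p.2.2 i)) (by fun_prop)

lemma measurable_weight (i : Fin n) : Measurable fun p : (Fin k → ℝ) × ℝ × (Fin n → ℝ) =>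
    weight p.1 p.2.2 p.2.1 i := by
  classical
  simp only [weight, indicator_apply]
  refine Measurable.ite ?_ (measurable_from_nat.comp measurable_hits_block).inv measurable_const
  exact measurableSet_eq_fun (Measurable.cnt (by fun_prop) (by fun_prop))
    (Measurable.cnt (by fun_prop) (by fun_prop))

lemma measurable_forestWeight (i : Fin n) :
    Measurable fun p : (Fin q × Fin k → ℝ) × ℝ × (Fin n → ℝ) =>
      forestWeight (fun l j => p.1 (l, j)) p.2.2 p.2.1 i := by
  refine (Finset.measurable_fun_sum _ fun l _ => ?_).const_mul _
  exact (measurable_weight i).comp (f := fun p : (Fin q × Fin k → ℝ) × ℝ × (Fin n → ℝ) =>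
    ((fun j => p.1 (l, j) : Fin k → ℝ), p.2)) (by fun_prop)

end Measurability

/-! ### The mean values inside the model -/

section ModelMeans

variable {μ : ℝ → ℝ} {ν : Measure ℝ} {n k q : ℕ} {Ω : Type*} [MeasurableSpace Ω] {P : Measure Ω}
  {X ε : Fin n → Ω → ℝ} {U : Fin q → Fin k → Ω → ℝ} {X₀ : Ω → ℝ}

lemma IsModel.aemeasurable (h : IsModel μ ν P X ε U X₀) {J : Type*} [Fintype J]
    (e : J → Fin q × Fin k) :
    AEMeasurable (fun ω => ((fun j => U (e j).1 (e j).2 ω : J → ℝ), X₀ ω, fun i => X i ω)) P :=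
  (aemeasurable_pi_lambda _ fun j => (h.law_split (e j).1 (e j).2).aemeasurable).prodMk
    (h.law_test.aemeasurable.prodMk
      (aemeasurable_pi_lambda _ fun i => (h.law_design i).aemeasurable))

lemma IsModel.ae_mem (h : IsModel μ ν P X ε U X₀) :
    ∀ᵐ ω ∂P, X₀ ω ∈ Ioc (0 : ℝ) 1 ∧ ∀ i, X i ω ∈ Ioc (0 : ℝ) 1 := by
  have key : ∀ {Y : Ω → ℝ}, HasLaw Y (designLaw μ) P → ∀ᵐ ω ∂P, Y ω ∈ Ioc (0 : ℝ) 1 := fun hY => by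
    have h1 := ae_designLaw_mem μ
    rw [← hY.map_eq] at h1
    exact ae_of_ae_map hY.aemeasurable h1
  exact (key h.law_test).and (ae_all_iff.2 fun i => key (h.law_design i))

variable [IsProbabilityMeasure P] [IsProbabilityMeasure (designLaw μ)]

lemma IsModel.meanLE (h : IsModel μ ν P X ε U X₀) {J : Type*} [Fintype J]
    {e : J → Fin q × Fin k} (he : Function.Injective e)
    {F : (J → ℝ) × ℝ × (Fin n → ℝ) → ℝ} (hF : Measurable F) (h0 : ∀ z, 0 ≤ F z) {b : ℝ}
    (hb : 0 ≤ b)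
    (hle : ∫⁻ u, ∫⁻ t, ∫⁻ x, ENNReal.ofReal (F (u, t, x)) ∂Measure.pi (fun _ => designLaw μ)
      ∂designLaw μ ∂Measure.pi (fun _ => unif) ≤ ENNReal.ofReal b) :
    MeanLE P (fun ω => F (fun j => U (e j).1 (e j).2 ω, X₀ ω, fun i => X i ω)) b := by
  refine MeanLE.of_lintegral_le (hF.comp_aemeasurable (h.aemeasurable e)) (fun ω => h0 _) hb ?_
  rw [h.lintegral_eq he hF.ennreal_ofReal]
  exact hle

lemma ofReal_inv_natCast_add_one (N : ℕ) :
    ENNReal.ofReal ((N : ℝ) + 1)⁻¹ = ((N : ℝ≥0∞) + 1)⁻¹ := by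
  rw [ENNReal.ofReal_inv_of_pos (by positivity), ENNReal.ofReal_add (by positivity) zero_le_one]
  simp

lemma IsModel.meanLE_inv_hits_block (h : IsModel μ ν P X ε U X₀) (l : Fin q) :
    MeanLE P (fun ω => ((hits (block (fun j => U l j ω) (X₀ ω)) fun i => X i ω : ℝ) + 1)⁻¹)
      (((k : ℝ) + 1) / (n + 1)) := by
  refine h.meanLE (e := fun j => (l, j)) (fun _ _ hij => (Prod.ext_iff.1 hij).2)
    (F := fun p => ((hits (block p.1 p.2.1) p.2.2 : ℝ) + 1)⁻¹)
    ((measurable_from_nat.comp measurable_hits_block).add_const 1).inv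
    (fun _ => by positivity) (by positivity) ?_
  simp only [ofReal_inv_natCast_add_one]
  refine (lintegral_inv_hits_block_le k n (designLaw μ)).trans_eq ?_
  rw [ENNReal.ofReal_div_of_pos (by positivity), ENNReal.ofReal_add (by positivity) zero_le_one,
    ENNReal.ofReal_add (by positivity) zero_le_one]
  simp

/-- As `l ≠ l'`, the splitting points of the two trees together form a family of k + k independent
uniform points, whose halves give back the two partitions. -/
lemma IsModel.meanLE_inv_hits_union (h : IsModel μ ν P X ε U X₀) {b : ℝ} (hb : 0 ≤ b)
    (hle : ∫⁻ u : Fin (k + k) → ℝ, ∫⁻ t, ∫⁻ x : Fin n → ℝ, ((hits (wide u t) x : ℝ≥0∞) + 1)⁻¹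
        ∂Measure.pi (fun _ => designLaw μ) ∂designLaw μ ∂Measure.pi (fun _ => unif)
      ≤ ENNReal.ofReal b) {l l' : Fin q} (hl : l ≠ l') :
    MeanLE P (fun ω => ((hits (block (fun j => U l j ω) (X₀ ω) ∪ block (fun j => U l' j ω) (X₀ ω))
      fun i => X i ω : ℝ) + 1)⁻¹) b := by
  set e := Fin.append (fun j : Fin k => (l, j)) fun j : Fin k => (l', j) with he
  have hL : ∀ j, e (Fin.castAdd k j) = (l, j) := fun j => Fin.append_left _ _ j
  have hR : ∀ j, e (Fin.natAdd k j) = (l', j) := fun j => Fin.append_right _ _ j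
  have hinj : Function.Injective e := by
    intro i j
    refine Fin.addCases (fun i => ?_) (fun i => ?_) i <;>
      refine Fin.addCases (fun j => ?_) (fun j => ?_) j <;>
      simp only [hL, hR, Prod.mk.injEq, hl, hl.symm, true_and, false_and, false_imp_iff] <;>
      exact fun hij => hij ▸ rfl
  have := h.meanLE hinj (F := fun p => ((hits (wide p.1 p.2.1) p.2.2 : ℝ) + 1)⁻¹)
    ((measurable_from_nat.comp measurable_hits_wide).add_const 1).inv
    (fun _ => by positivity) hb (by simpa only [ofReal_inv_natCast_add_one] using hle)
  have h1 : ∀ ω, fstHalf (fun j => U (e j).1 (e j).2 ω) = fun j => U l j ω := fun ω =>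
    funext fun j => by rw [fstHalf, hL]
  have h2 : ∀ ω, sndHalf (fun j => U (e j).1 (e j).2 ω) = fun j => U l' j ω := fun ω =>
    funext fun j => by rw [sndHalf, hR]
  simpa only [wide, h1, h2] using this

lemma IsModel.meanLE_hits_lt (h : IsModel μ ν P X ε U X₀) {K : ℕ} {b : ℝ} (hb : 0 ≤ b)
    (hle : ∫⁻ u : Fin k → ℝ, ∫⁻ t, Measure.pi (fun _ : Fin n => designLaw μ)
        {x | hits (block u t) x < K} ∂designLaw μ ∂Measure.pi (fun _ => unif)
      ≤ ENNReal.ofReal b) (l : Fin q) :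
    MeanLE P (fun ω => {N : ℕ | N < K}.indicator (1 : ℕ → ℝ)
      (hits (block (fun j => U l j ω) (X₀ ω)) fun i => X i ω)) b := by
  refine h.meanLE (e := fun j => (l, j)) (fun _ _ hij => (Prod.ext_iff.1 hij).2)
    (F := fun p => {N : ℕ | N < K}.indicator (1 : ℕ → ℝ) (hits (block p.1 p.2.1) p.2.2))
    (Measurable.comp (g := {N : ℕ | N < K}.indicator (1 : ℕ → ℝ)) measurable_from_nat
      measurable_hits_block)
    (fun _ => indicator_nonneg (fun _ _ => zero_le_one) _) hb ?_
  refine le_trans (le_of_eq ?_) hle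
  refine lintegral_congr fun u => lintegral_congr fun t => ?_
  have hset : MeasurableSet {x : Fin n → ℝ | hits (block u t) x < K} :=
    measurable_hits (measurableSet_block u t) measurableSet_Iio
  rw [← lintegral_indicator_one hset]
  refine lintegral_congr fun x => ?_
  by_cases hx : hits (block u t) x < K <;> simp [hx]

lemma IsModel.meanLE_sq_measure_block {M : ℝ} (hle : ∀ x ∈ Icc (0 : ℝ) 1, μ x ≤ M) (hM : 0 ≤ M)
    (h : IsModel μ ν P X ε U X₀) (l : Fin q) :
    MeanLE P (fun ω => unif.real (block (fun j => U l j ω) (X₀ ω)) ^ 2)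
      (M * (6 / ((k + 3) * (k + 2)))) := by
  refine h.meanLE (e := fun j => (l, j)) (fun _ _ hij => (Prod.ext_iff.1 hij).2)
    (F := fun p => unif.real (block p.1 p.2.1) ^ 2)
    (((measurable_measure_block unif).comp (f := fun p : (Fin k → ℝ) × ℝ × (Fin n → ℝ) =>
      (p.1, p.2.1)) (by fun_prop)).ennreal_toReal.pow_const 2)
    (fun _ => by positivity) (by positivity) ?_
  have h2 : ∀ A : Set ℝ, ENNReal.ofReal (unif.real A ^ 2) = unif A ^ 2 := fun A => by
    rw [ENNReal.ofReal_pow measureReal_nonneg, ofReal_measureReal]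
  simp only [h2, lintegral_const, measure_univ, mul_one]
  refine (lintegral_sq_measure_block_designLaw_le hle k).trans_eq ?_
  rw [ENNReal.ofReal_mul hM, ENNReal.ofReal_div_of_pos (by positivity),
    ENNReal.ofReal_mul (by positivity), ENNReal.ofReal_add (by positivity) (by positivity),
    ENNReal.ofReal_add (by positivity) (by positivity)]
  simp

end ModelMeans

/-! ### Risk bounds for fixed n, k and q -/

section Risk

variable {μ : ℝ → ℝ} {ν : Measure ℝ} {n k q : ℕ} {Ω : Type*} [MeasurableSpace Ω] {P : Measure Ω}
  {X ε : Fin n → Ω → ℝ} {U : Fin q → Fin k → Ω → ℝ} {X₀ : Ω → ℝ}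
  [IsProbabilityMeasure P] [IsProbabilityMeasure ν] [IsProbabilityMeasure (designLaw μ)]

lemma IsModel.meanLE_sqError (h : IsModel μ ν P X ε U X₀) {s : ℝ → ℝ} {C : ℝ≥0}
    (hs : LipschitzOnWith C s (Icc 0 1)) {σ : ℝ} (hL2 : MemLp id 2 ν) (hmean : ∫ e, e ∂ν = 0)
    (hvar : Var[id; ν] = σ ^ 2) {ψ : Ω → ℝ} {B : ℝ} (hB : 0 ≤ B) (hψB : MeanLE P ψ B)
    (hψ : ∀ ω, X₀ ω ∈ Icc (0 : ℝ) 1 → (∀ i, X i ω ∈ Icc (0 : ℝ) 1) →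
      σ ^ 2 * ∑ i, forestWeight (fun l j => U l j ω) (fun i => X i ω) (X₀ ω) i ^ 2
        + (∑ i, forestWeight (fun l j => U l j ω) (fun i => X i ω) (X₀ ω) i * s (X i ω)
          - s (X₀ ω)) ^ 2 ≤ ψ ω) :
    MeanLE P (sqError s X ε U X₀) B := by
  -- Outside [0, 1] nothing is known about `s`, not even measurability; a Lipschitz extension is
  -- measurable and agrees with `s` at almost all design and test points.
  obtain ⟨g, hg, hsg⟩ := hs.extend_real
  have hgm : Measurable g := hg.continuous.measurable
  let a : Fin n → (Fin q × Fin k → ℝ) × ℝ × (Fin n → ℝ) → ℝ := fun i p =>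
    forestWeight (fun l j => p.1 (l, j)) p.2.2 p.2.1 i
  let b : (Fin q × Fin k → ℝ) × ℝ × (Fin n → ℝ) → ℝ := fun p =>
    ∑ i, a i p * g (p.2.2 i) - g p.2.1
  have ha : ∀ i, Measurable (a i) := measurable_forestWeight
  have hb : Measurable b := by
    refine (Finset.measurable_fun_sum _ fun i _ => (ha i).mul (hgm.comp ?_)).sub (hgm.comp ?_) <;>
      fun_prop
  let T : Ω → (Fin q × Fin k → ℝ) × ℝ × (Fin n → ℝ) := fun ω =>
    (fun p => U p.1 p.2 ω, X₀ ω, fun i => X i ω)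
  have hT : AEMeasurable T P := h.aemeasurable id
  have hae : sqError s X ε U X₀ =ᵐ[P] fun ω => (∑ i, a i (T ω) * ε i ω + b (T ω)) ^ 2 := by
    filter_upwards [h.ae_mem] with ω hω
    have h0 := hsg (Ioc_subset_Icc_self hω.1)
    have hi := fun i => hsg (Ioc_subset_Icc_self (hω.2 i))
    simp only [sqError, forest_eq_sum_forestWeight _ _ hω.1 hω.2, b, a, T, ← h0, ← hi, mul_add,
      Finset.sum_add_distrib]
    ring
  have hmeas : AEMeasurable (sqError s X ε U X₀) P := by
    refine AEMeasurable.congr ?_ hae.symm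
    refine ((Finset.aemeasurable_fun_sum _ fun i _ => ?_).add
      (hb.comp_aemeasurable hT)).pow_const 2
    exact ((ha i).comp_aemeasurable hT).mul (h.law_noise i).aemeasurable
  have hψ' : ∀ᵐ ω ∂P, σ ^ 2 * ∑ i, a i (T ω) ^ 2 + b (T ω) ^ 2 ≤ ψ ω := by
    filter_upwards [h.ae_mem] with ω hω
    have h0 := hsg (Ioc_subset_Icc_self hω.1)
    have hi := fun i => hsg (Ioc_subset_Icc_self (hω.2 i))
    have := hψ ω (Ioc_subset_Icc_self hω.1) fun i => Ioc_subset_Icc_self (hω.2 i)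
    simpa only [b, a, T, ← h0, ← hi] using this
  refine MeanLE.of_lintegral_le hmeas (fun ω => sq_nonneg _) hB ?_
  calc _ = ∫⁻ ω, ENNReal.ofReal ((∑ i, a i (T ω) * ε i ω + b (T ω)) ^ 2) ∂P :=
        lintegral_congr_ae (hae.mono fun ω hω => by rw [hω])
    _ = ∫⁻ ω, ENNReal.ofReal (σ ^ 2 * ∑ i, a i (T ω) ^ 2 + b (T ω) ^ 2) ∂P :=
        h.lintegral_noise_eq hL2 hmean hvar ha hb
    _ ≤ ∫⁻ ω, ENNReal.ofReal (ψ ω) ∂P :=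
        lintegral_mono_ae (hψ'.mono fun ω hω => ENNReal.ofReal_le_ofReal hω)
    _ ≤ _ := hψB.lintegral_le (hψ'.mono fun ω hω => le_trans (by positivity) hω)

lemma IsModel.meanLE_sqError_crude (h : IsModel μ ν P X ε U X₀) {s : ℝ → ℝ} {C : ℝ≥0}
    (hs : LipschitzOnWith C s (Icc 0 1)) {S : ℝ} (hS : ∀ x ∈ Icc (0 : ℝ) 1, |s x| ≤ S) {σ : ℝ}
    (hL2 : MemLp id 2 ν) (hmean : ∫ e, e ∂ν = 0) (hvar : Var[id; ν] = σ ^ 2) :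
    MeanLE P (sqError s X ε U X₀) (σ ^ 2 + (2 * S) ^ 2) := by
  refine h.meanLE_sqError hs hL2 hmean hvar (by positivity)
    (ψ := fun _ => σ ^ 2 + (2 * S) ^ 2) ⟨integrable_const _, by simp⟩ fun ω h0 hi => ?_
  exact add_le_add (mul_le_of_le_one_right (sq_nonneg σ) (sum_forestWeight_sq_le_one _ _ _))
    (forest_bias_sq_le_crude hS _ h0 hi)

/-- Of the q² pairs of trees, the q diagonal ones carry total weight 1/q, so the union bound `b`
dominates. The bound `b'` on sparse cells enters both the variance and the bias. -/
lemma IsModel.meanLE_sqError_of_bounds (h : IsModel μ ν P X ε U X₀) {s : ℝ → ℝ} {C : ℝ≥0}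
    (hs : LipschitzOnWith C s (Icc 0 1)) {S : ℝ} (hS : ∀ x ∈ Icc (0 : ℝ) 1, |s x| ≤ S) {σ : ℝ}
    (hL2 : MemLp id 2 ν) (hmean : ∫ e, e ∂ν = 0) (hvar : Var[id; ν] = σ ^ 2) {M : ℝ}
    (hμ : ∀ x ∈ Icc (0 : ℝ) 1, μ x ≤ M) (hM : 0 ≤ M) (hq : 1 ≤ q) {K : ℕ} (hK : 1 ≤ K)
    {b b' : ℝ} (hb : 0 ≤ b) (hb' : 0 ≤ b')
    (hwide : ∫⁻ u : Fin (k + k) → ℝ, ∫⁻ t, ∫⁻ x : Fin n → ℝ, ((hits (wide u t) x : ℝ≥0∞) + 1)⁻¹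
        ∂Measure.pi (fun _ => designLaw μ) ∂designLaw μ ∂Measure.pi (fun _ => unif)
      ≤ ENNReal.ofReal b)
    (hlt : ∫⁻ u : Fin k → ℝ, ∫⁻ t, Measure.pi (fun _ : Fin n => designLaw μ)
        {x | hits (block u t) x < K} ∂designLaw μ ∂Measure.pi (fun _ => unif)
      ≤ ENNReal.ofReal b') :
    MeanLE P (sqError s X ε U X₀)
      (σ ^ 2 * (2 * (((k : ℝ) + 1) / (n + 1)) / q + (1 + 1 / (K : ℝ)) * b + b')
        + ((C : ℝ) ^ 2 * (M * (6 / ((k + 3) * (k + 2)))) + S ^ 2 * b')) := by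
  have hq' : (0 : ℝ) < q := by exact_mod_cast hq
  set V : Fin q → Ω → Fin k → ℝ := fun l ω j => U l j ω
  set x : Ω → Fin n → ℝ := fun ω i => X i ω
  set b₁ : ℝ := ((k : ℝ) + 1) / (n + 1)
  set ind : Fin q → Ω → ℝ := fun l ω =>
    {N : ℕ | N < K}.indicator (1 : ℕ → ℝ) (hits (block (V l ω) (X₀ ω)) (x ω))
  set g : Fin q × Fin q → Ω → ℝ := fun p ω =>
    if p.1 = p.2 then 2 * ((hits (block (V p.1 ω) (X₀ ω)) (x ω) : ℝ) + 1)⁻¹ else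
      (1 + 1 / (K : ℝ)) *
        ((hits (block (V p.1 ω) (X₀ ω) ∪ block (V p.2 ω) (X₀ ω)) (x ω) : ℝ) + 1)⁻¹ + ind p.1 ω
  set d : Fin q → Ω → ℝ := fun l ω =>
    (C : ℝ) ^ 2 * unif.real (block (V l ω) (X₀ ω)) ^ 2 + S ^ 2 * ind l ω
  have hind : ∀ l, MeanLE P (ind l) b' := h.meanLE_hits_lt hb' hlt
  -- The off-diagonal bound is also granted to the diagonal pairs, so that it sums to q² equal
  -- terms.
  have hg : ∀ p, MeanLE P (g p)
      ((if p.1 = p.2 then 2 * b₁ else 0) + ((1 + 1 / (K : ℝ)) * b + b')) := by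
    rintro ⟨l, l'⟩
    by_cases hl : l = l'
    · simp only [g, hl, if_true]
      refine ((h.meanLE_inv_hits_block l').const_mul zero_le_two).trans ?_
      have : 0 ≤ (1 + 1 / (K : ℝ)) * b + b' := by positivity
      linarith
    · simp only [g, hl, if_false, zero_add]
      exact ((h.meanLE_inv_hits_union hb hwide hl).const_mul (by positivity)).add (hind l)
  have hd : ∀ l, MeanLE P (d l) ((C : ℝ) ^ 2 * (M * (6 / ((k + 3) * (k + 2)))) + S ^ 2 * b') :=
    fun l => ((h.meanLE_sq_measure_block hμ hM l).const_mul (sq_nonneg _)).add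
      ((hind l).const_mul (sq_nonneg _))
  have hsum : MeanLE P
      (fun ω => σ ^ 2 * ((1 / (q : ℝ)) ^ 2 * ∑ p, g p ω) + 1 / (q : ℝ) * ∑ l, d l ω) _ :=
    ((((MeanLE.sum fun p _ => hg p).const_mul (by positivity)).const_mul (sq_nonneg σ))).add
      ((MeanLE.sum fun l _ => hd l).const_mul (by positivity))
  refine h.meanLE_sqError hs hL2 hmean hvar (by positivity) (hsum.trans (le_of_eq ?_))
    fun ω h0 hi => ?_
  · have hdiag : ∑ p : Fin q × Fin q, (if p.1 = p.2 then 2 * b₁ else 0) = q * (2 * b₁) := by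
      rw [Fintype.sum_prod_type]
      simp
    rw [Finset.sum_add_distrib, hdiag]
    simp only [Finset.sum_const, Finset.card_univ, Fintype.card_prod, Fintype.card_fin,
      nsmul_eq_mul, Nat.cast_mul]
    field_simp
    ring
  · refine add_le_add (mul_le_mul_of_nonneg_left ?_ (sq_nonneg σ))
      ((forest_bias_sq_le s hq _ _ _).trans ?_)
    · rw [sum_forestWeight_sq_eq]
      gcongr with p _
      by_cases hp : p.1 = p.2
      · simp only [g, hp, if_true]
        exact sum_weight_sq_le _ _ _
      · simp only [g, hp, if_false]
        exact sum_weight_mul_weight_le _ _ _ _ hK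
    · gcongr with l _
      exact bias_sq_le hs hS _ h0 hi hK

end Risk

/-! ### Choice of the constants and the error term -/

section Asymptotic

lemma exp_neg_div_le {c y : ℝ} (hc : 0 < c) (hy : 0 < y) :
    Real.exp (-(c / y)) ≤ 720 / c ^ 6 * y ^ 6 := by
  have h := Real.pow_div_factorial_le_exp (c / y) (by positivity) 6
  rw [Real.exp_neg, inv_eq_one_div, div_le_iff₀ (Real.exp_pos _)]
  calc (1 : ℝ) = 720 / c ^ 6 * y ^ 6 * ((c / y) ^ 6 / (Nat.factorial 6 : ℕ)) := by
        simp only [Nat.factorial]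
        push_cast
        field_simp
    _ ≤ _ := by gcongr

/-- The error term of the risk bound, relative to `ρ = k / n`, with `y = ρ ^ (1 / 4)`. -/
def relError (σ S c Q y : ℝ) (k q : ℕ) : ℝ :=
  σ ^ 2 * (4 / q + (3 + 2 * c) / k) + (σ ^ 2 + S ^ 2) * (Q * y ^ 2)

lemma exists_meanLE_sqError {μ s : ℝ → ℝ} {M : ℝ} {C : ℝ≥0} {ν : Measure ℝ}
    [IsProbabilityMeasure ν] {σ S : ℝ} (hcont : ContinuousOn μ (Icc 0 1))
    (hpos : ∀ x ∈ Icc (0 : ℝ) 1, 0 < μ x) (hle : ∀ x ∈ Icc (0 : ℝ) 1, μ x ≤ M)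
    (hint : ∫ x in (0 : ℝ)..1, μ x = 1) (hs : LipschitzOnWith C s (Icc 0 1))
    (hS : ∀ x ∈ Icc (0 : ℝ) 1, |s x| ≤ S) (hL2 : MemLp id 2 ν) (hmean : ∫ e, e ∂ν = 0)
    (hvar : Var[id; ν] = σ ^ 2) :
    ∃ c Q : ℝ, ∀ (n k q : ℕ) (y : ℝ), 1 ≤ n → 1 ≤ k → 1 ≤ q → 0 < y → y ^ 3 ≤ 1 / 2 →
      y ^ 4 = (k : ℝ) / n → ∀ (Ω : Type*) [MeasurableSpace Ω] (P : Measure Ω)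
        [IsProbabilityMeasure P] (X ε : Fin n → Ω → ℝ) (U : Fin q → Fin k → Ω → ℝ) (X₀ : Ω → ℝ),
        IsModel μ ν P X ε U X₀ → MeanLE P (sqError s X ε U X₀)
          (3 / 4 * (σ ^ 2 * ((k : ℝ) + 1) / n) + 6 * M * (C : ℝ) ^ 2 / ((k : ℝ) + 1) ^ 2
            + (k : ℝ) / n * relError σ S c Q y k q) := by
  have hD := isProbabilityMeasure_designLaw hcont hpos hint
  obtain ⟨m, hm, hmμ⟩ := exists_pos_le_of_continuousOn hcont hpos
  obtain ⟨c, hc, hwide⟩ := exists_lintegral_inv_hits_wide_le hcont hpos hint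
  have hM : 0 ≤ M :=
    (hpos 0 (by simp)).le.trans (hle 0 (by simp))
  refine ⟨c, 2 ^ 100 * (M * 3 + 720 / (m / 2) ^ 6), ?_⟩
  intro n k q y hn hk hq hy hy3 hy4 Ω _ P _ X ε U X₀ hmodel
  have hn' : (1 : ℝ) ≤ n := by exact_mod_cast hn
  have hk' : (1 : ℝ) ≤ k := by exact_mod_cast hk
  have hq' : (1 : ℝ) ≤ q := by exact_mod_cast hq
  set ρ : ℝ := (k : ℝ) / n with hρ
  set Q : ℝ := 2 ^ 100 * (M * 3 + 720 / (m / 2) ^ 6) with hQ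
  have hρ0 : 0 < ρ := by positivity
  have hlt : ∫⁻ u : Fin k → ℝ, ∫⁻ t, Measure.pi (fun _ : Fin n => designLaw μ)
        {x | hits (block u t) x < 100} ∂designLaw μ ∂Measure.pi (fun _ => unif)
      ≤ ENNReal.ofReal (ρ * (Q * y ^ 2)) := by
    -- This makes (kτ)² = y ^ 6 = ρ y ^ 2, which is o(ρ), while nτ = 1/y tends to infinity. The
    -- exponential is then exp(-(m/2)/y), bounded by a multiple of y ^ 6 as well.
    set τ : ℝ := y ^ 3 / k with hτ
    have hτ2 : τ ≤ 1 / 2 := (div_le_self (by positivity) hk').trans hy3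
    refine (lintegral_measure_hits_lt_le hm.le hmμ hle hk 100 hτ2).trans ?_
    have e1 : (k : ℝ≥0∞) * ENNReal.ofReal τ = ENNReal.ofReal (y ^ 3) := by
      rw [← ENNReal.ofReal_natCast, ← ENNReal.ofReal_mul (by positivity)]
      congr 1
      rw [hτ]; field_simp
    have e2 : n * (m * τ) / 2 = m / 2 / y := by
      have hkn : (k : ℝ) = y ^ 4 * n := by rw [hy4, hρ]; field_simp
      rw [hτ, hkn]; field_simp
    have e3 : (2 : ℝ≥0∞) ^ 100 = ENNReal.ofReal (2 ^ 100) := by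
      rw [ENNReal.ofReal_pow zero_le_two, ENNReal.ofReal_ofNat]
    have e4 : (3 : ℝ≥0∞) = ENNReal.ofReal 3 := (ENNReal.ofReal_ofNat 3).symm
    rw [e1, e2, e3, e4, ← ENNReal.ofReal_pow (by positivity), ← ENNReal.ofReal_mul (by positivity),
      ← ENNReal.ofReal_mul hM, ← ENNReal.ofReal_add (by positivity) (Real.exp_nonneg _),
      ← ENNReal.ofReal_mul (by positivity)]
    refine ENNReal.ofReal_le_ofReal ?_
    calc _ ≤ 2 ^ 100 * (M * (3 * (y ^ 3) ^ 2) + 720 / (m / 2) ^ 6 * y ^ 6) := by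
          gcongr
          exact exp_neg_div_le (by positivity) hy
      _ = ρ * (Q * y ^ 2) := by rw [← hy4, hQ]; ring
  -- Any K ≥ 80 would do, as (1 + 1/K) · (10/9) · (2/3) ≤ 3/4 is all that is required.
  refine (hmodel.meanLE_sqError_of_bounds hs hS hL2 hmean hvar hle hM hq (K := 100) (by norm_num)
    (by positivity) (by positivity) (hwide k n) hlt).trans ?_
  have b1 : 2 * (((k : ℝ) + 1) / (n + 1)) / q ≤ ρ * (4 / q) := by
    have h1 : ((k : ℝ) + 1) / (n + 1) ≤ 2 * k / n := by gcongr <;> linarith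
    calc _ ≤ 2 * (2 * (k : ℝ) / n) / q := by gcongr
      _ = ρ * (4 / q) := by rw [hρ]; ring
  -- The coefficient of k on the left is (101/100)(10/9)(2/3) = 101/135 < 3/4; the remaining
  -- constants go into (3 + 2c)/n, which is ρ times a quantity of order 1/k.
  have b2 : (1 + 1 / ((100 : ℕ) : ℝ)) * ((10 / 9 * ((2 * k + 7) / 3) + c) / (n + 1))
      ≤ 3 / 4 * (((k : ℝ) + 1) / n) + ρ * ((3 + 2 * c) / k) := by
    have h1 : ρ * ((3 + 2 * c) / k) = (3 + 2 * c) / n := by rw [hρ]; field_simp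
    rw [h1]
    calc _ = (101 / 100 * (10 / 9 * ((2 * k + 7) / 3) + c)) / (n + 1) := by push_cast; ring
      _ ≤ (3 / 4 * (k + 1) + (3 + 2 * c)) / n :=
          div_le_div₀ (by positivity) (by linarith) (by positivity) (by linarith)
      _ = _ := by ring
  have b3 : (C : ℝ) ^ 2 * (M * (6 / ((k + 3) * (k + 2))))
      ≤ 6 * M * (C : ℝ) ^ 2 / ((k : ℝ) + 1) ^ 2 := by
    calc _ = 6 * M * (C : ℝ) ^ 2 / ((k + 3) * (k + 2)) := by ring
      _ ≤ _ := div_le_div_of_nonneg_left (by positivity) (by positivity) (by nlinarith)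
  have b4 := mul_le_mul_of_nonneg_left (add_le_add b1 b2) (sq_nonneg σ)
  calc _ ≤ _ := add_le_add (le_of_eq (by rw [mul_add])) (add_le_add b3 le_rfl)
    _ ≤ _ := add_le_add (add_le_add b4 le_rfl) le_rfl
    _ = _ := by rw [relError]; ring

end Asymptotic

end PURF

end

/-! ### The theorem -/

theorem mainTheorem1
    (μ s : ℝ → ℝ) (M : ℝ) (C : ℝ≥0) (ν : Measure ℝ) [IsProbabilityMeasure ν] (σ : ℝ)
    (k q : ℕ → ℕ)
    -- `μ` is a continuous probability density on `[0, 1]` with `0 < μ ≤ M`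
    (hμ_cont : ContinuousOn μ (Icc 0 1))
    (hμ_pos : ∀ x ∈ Icc (0 : ℝ) 1, 0 < μ x)
    (hμ_le : ∀ x ∈ Icc (0 : ℝ) 1, μ x ≤ M)
    (hμ_int : ∫ x in (0 : ℝ)..1, μ x = 1)
    -- the regression function is `C`-Lipschitz
    (hs : LipschitzOnWith C s (Icc 0 1))
    -- the noise law `ν` is centred with finite variance `σ ^ 2`
    (hν_L2 : MemLp id 2 ν)
    (hν_mean : ∫ e, e ∂ν = 0)
    (hν_var : Var[id; ν] = σ ^ 2)
    (hk : Tendsto k atTop atTop)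
    (hkn : Tendsto (fun n => (k n : ℝ) / (n : ℝ)) atTop (𝓝 0))
    (hq : Tendsto q atTop atTop) :
    ∃ r : ℕ → ℝ, (r =o[atTop] fun n => (k n : ℝ) / (n : ℝ)) ∧
      ∀ (n : ℕ) (Ω : Type*) [MeasurableSpace Ω] (P : Measure Ω) [IsProbabilityMeasure P]
        (X ε : Fin n → Ω → ℝ) (U : Fin (q n) → Fin (k n) → Ω → ℝ) (X₀ : Ω → ℝ),
        PURF.IsModel μ ν P X ε U X₀ →
          Integrable (PURF.sqError s X ε U X₀) P ∧
          ∫ ω, PURF.sqError s X ε U X₀ ω ∂P ≤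
            3 / 4 * (σ ^ 2 * ((k n : ℝ) + 1) / (n : ℝ))
              + 6 * M * (C : ℝ) ^ 2 / ((k n : ℝ) + 1) ^ 2 + r n := by
  classical
  have hD := PURF.isProbabilityMeasure_designLaw hμ_cont hμ_pos hμ_int
  have hM : 0 ≤ M := (hμ_pos 0 (by simp)).le.trans (hμ_le 0 (by simp))
  obtain ⟨S, hS⟩ := isCompact_Icc.exists_bound_of_continuousOn hs.continuousOn
  simp only [Real.norm_eq_abs] at hS
  obtain ⟨c, Q, hrisk⟩ := PURF.exists_meanLE_sqError hμ_cont hμ_pos hμ_le hμ_int hs hS hν_L2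
    hν_mean hν_var
  set y : ℕ → ℝ := fun n => ((k n : ℝ) / n) ^ (1 / 4 : ℝ) with hy
  have hy0 : Tendsto y atTop (𝓝 0) := by
    have := hkn.rpow_const (p := 1 / 4) (Or.inr (by norm_num))
    rwa [Real.zero_rpow (by norm_num)] at this
  have hy4 : ∀ n, y n ^ 4 = (k n : ℝ) / n := fun n => by
    rw [hy, ← Real.rpow_natCast, ← Real.rpow_mul (by positivity)]
    norm_num
  let good : ℕ → Prop := fun n => 1 ≤ n ∧ 1 ≤ k n ∧ 1 ≤ q n ∧ y n ^ 3 ≤ 1 / 2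
  have hgood : ∀ᶠ n in atTop, good n := by
    have h3 : Tendsto (fun n => y n ^ 3) atTop (𝓝 0) := by simpa using hy0.pow 3
    filter_upwards [eventually_ge_atTop 1, hk.eventually_ge_atTop 1, hq.eventually_ge_atTop 1,
      h3.eventually_le_const (by norm_num : (0 : ℝ) < 1 / 2)] with n h1 h2 h3 h4
      using ⟨h1, h2, h3, h4⟩
  -- The bound must hold for every n. The finitely many n that are not good, where k or q may
  -- vanish, receive the crude bound on the risk; they do not affect the little-o.
  refine ⟨fun n => if good n then (k n : ℝ) / n * PURF.relError σ S c Q (y n) (k n) (q n)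
    else σ ^ 2 + (2 * S) ^ 2, ?_, ?_⟩
  · have hlim : Tendsto (fun n => PURF.relError σ S c Q (y n) (k n) (q n)) atTop (𝓝 0) := by
      have hkR : Tendsto (fun n => (k n : ℝ)) atTop atTop := tendsto_natCast_atTop_atTop.comp hk
      have hqR : Tendsto (fun n => (q n : ℝ)) atTop atTop := tendsto_natCast_atTop_atTop.comp hq
      have h1 := ((hqR.const_div_atTop 4).add (hkR.const_div_atTop (3 + 2 * c))).const_mul (σ ^ 2)
      have h2 := ((hy0.pow 2).const_mul Q).const_mul (σ ^ 2 + S ^ 2)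
      simpa [PURF.relError] using h1.add h2
    have ho := (isBigO_refl (fun n => (k n : ℝ) / n) atTop).mul_isLittleO
      ((isLittleO_one_iff ℝ).2 hlim)
    simp only [mul_one] at ho
    exact ho.congr' (hgood.mono fun n hn => (if_pos hn).symm) EventuallyEq.rfl
  · intro n Ω _ P _ X ε U X₀ hmodel
    by_cases hn : good n
    · simp only [hn, if_true]
      obtain ⟨h1, h2, h3, h4⟩ := hn
      have : (0 : ℝ) < n := by exact_mod_cast h1
      have : (0 : ℝ) < k n := by exact_mod_cast h2
      exact hrisk n (k n) (q n) (y n) h1 h2 h3 (Real.rpow_pos_of_pos (by positivity) _) h4 (hy4 n)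
        Ω P X ε U X₀ hmodel
    · simp only [hn, if_false]
      refine (hmodel.meanLE_sqError_crude hs hS hν_L2 hν_mean hν_var).trans ?_
      refine le_add_of_nonneg_left ?_
      positivity
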